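/- Let $K$ be a field and let $\mathcal O_1,\mathcal O_2$ be symmetric operads over $K$ (with components $\mathcal O_i(n)$, $n\ge 1$) such that $\dim\mathcal O_i(1)=1$, i.e. $\mathcal O_i(1)=K\,\mathrm{id}\neq 0$; for instance, non-zero binary operads. Let $\mathcal O=\mathcal O_1*\mathcal O_2$, with morphisms $\pi_i:\mathcal O_i\to\mathcal O$, be their free product, i.e. for every operad $\mathcal P$ and all morphisms $\psi_i:\mathcal O_i\to\mathcal P$ there is a unique morphism $\psi:\mathcal O\to\mathcal P$ with $\psi\pi_i=\psi_i$, $i=1,2$. Define the $\bullet$-part $\mathcal O(n)^\bullet$ and the $\circ$-part $\mathcal O(n)^\circ$ of $\mathcal O(n)$ recursively: $\mathcal O(n)^\bullet$ (respectively $\mathcal O(n)^\circ$) is the linear span of all elements $\gamma^m_{n_1,\dots,n_m}(\pi_1(\mu),t_1,\dots,t_m)^\sigma$ (respectively with $\pi_2(\mu)$), where $m\ge 2$, $n_1+\dots+n_m=n$, $\sigma\in S_n$, $\mu\in\mathcal O_1(m)$ (respectively $\mu\in\mathcal O_2(m)$), and each $t_i$ is either $\mathrm{id}$ (with $n_i=1$)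 or an element of $\mathcal O(n_i)^\circ$ (respectively $\mathcal O(n_i)^\bullet$). Put $x_m=\dim\mathcal O_1(m)$, $y_m=\dim\mathcal O_2(m)$, $d_n^\bullet=\dim\mathcal O(n)^\bullet$, $d_n^\circ=\dim\mathcal O(n)^\circ$ (dimensions are cardinal numbers if they are infinite). Then $\mathcal O(n)=\mathcal O(n)^\bullet\oplus\mathcal O(n)^\circ$ for all $n\ge 2$, and \begin{align*} d_3^\bullet={}&x_3+3x_2y_2,\\ d_4^\bullet={}&x_4+6x_3y_2+3x_2y_2^2+4x_2y_3+12x_2^2y_2,\\ d_5^\bullet={}&x_5+10x_4y_2+5x_2y_4+15x_3y_2^2+30x_2^2y_3+50x_2x_3y_2+10x_2y_2y_3\\ &+90x_2^2y_2^2+15x_2^3y_2+10x_3y_3, \end{align*} and $d_3^\circ,d_4^\circ,d_5^\circ$ are given by the same formulas with $x$ and $y$ interchanged. -/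

import Mathlib

universe u

/-- Grafting order: summing over the inputs of the composite of `k`-ary operations
is the same as summing block by block. -/
theorem sum_finSigma {m : ℕ} (k : Fin m → ℕ) (l : (i : Fin m) → Fin (k i) → ℕ) :
    ∑ p : Fin (∑ i, k i), l (finSigmaFinEquiv.symm p).1 (finSigmaFinEquiv.symm p).2 =
      ∑ i, ∑ j, l i j := by
  rw [← Fintype.sum_sigma' (fun i j => l i j)]
  exact Fintype.sum_equiv finSigmaFinEquiv.symm _ _ (fun _ => rfl)

/-- A symmetric operad over a field `K`, with components `obj n`, `n ≥ 1`
(the component in arity `0` is zero).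

* `map e` relabels the inputs along a bijection `e`. As `Fin m ≃ Fin n` forces `m = n`, this is
  exactly the datum of an action of the symmetric group `Equiv.Perm (Fin n)` on each `obj n`;
  `map (finCongr h)` is the transport along an equality `h` of arities.
* `comp k μ ν` is the composition `γ(μ; ν₁, …, νₘ)`; the inputs of the composite are the pairs
  `(i, j)`, with `j` an input of `νᵢ`, in lexicographic order (`finSigmaFinEquiv`). -/
structure SymmOperad (K : Type u) [Field K] where
  obj : ℕ → Type u
  [addCommGroup : ∀ n, AddCommGroup (obj n)]
  [module : ∀ n, Module K (obj n)]
  obj_zero : Subsingleton (obj 0)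
  map : {m n : ℕ} → (Fin m ≃ Fin n) → obj m →ₗ[K] obj n
  map_refl : ∀ (n : ℕ) (μ : obj n), map (Equiv.refl (Fin n)) μ = μ
  map_trans : ∀ {l m n : ℕ} (e : Fin l ≃ Fin m) (f : Fin m ≃ Fin n) (μ : obj l),
    map (e.trans f) μ = map f (map e μ)
  one : obj 1
  comp : {m : ℕ} → (k : Fin m → ℕ) →
    obj m →ₗ[K] MultilinearMap K (fun i => obj (k i)) (obj (∑ i, k i))
  one_comp : ∀ (n : ℕ) (μ : obj n),
    comp (fun _ : Fin 1 => n) one (fun _ => μ) = map (finCongr (by simp)) μ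
  comp_one : ∀ (n : ℕ) (μ : obj n),
    comp (fun _ : Fin n => 1) μ (fun _ => one) = map (finCongr (by simp)) μ
  assoc : ∀ {m : ℕ} (k : Fin m → ℕ) (l : (i : Fin m) → Fin (k i) → ℕ)
    (μ : obj m) (ν : (i : Fin m) → obj (k i)) (ξ : (i : Fin m) → (j : Fin (k i)) → obj (l i j)),
    map (finCongr (sum_finSigma k l))
        (comp (fun p => l (finSigmaFinEquiv.symm p).1 (finSigmaFinEquiv.symm p).2)
          (comp k μ ν)
          (fun p => ξ (finSigmaFinEquiv.symm p).1 (finSigmaFinEquiv.symm p).2)) =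
      comp (fun i => ∑ j, l i j) μ (fun i => comp (l i) (ν i) (ξ i))
  comp_map_left : ∀ {m m' : ℕ} (σ : Fin m ≃ Fin m') (k : Fin m' → ℕ)
    (μ : obj m) (ν : (i : Fin m') → obj (k i)),
    comp k (map σ μ) ν =
      map (finSigmaFinEquiv.symm.trans
          ((Equiv.sigmaCongrLeft (β := fun i => Fin (k i)) σ).trans finSigmaFinEquiv))
        (comp (fun i => k (σ i)) μ (fun i => ν (σ i)))
  comp_map_right : ∀ {m : ℕ} (k k' : Fin m → ℕ) (τ : (i : Fin m) → Fin (k i) ≃ Fin (k' i))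
    (μ : obj m) (ν : (i : Fin m) → obj (k i)),
    comp k' μ (fun i => map (τ i) (ν i)) =
      map (finSigmaFinEquiv.symm.trans ((Equiv.sigmaCongrRight τ).trans finSigmaFinEquiv))
        (comp k μ ν)

namespace SymmOperad

attribute [instance] SymmOperad.addCommGroup SymmOperad.module

variable {K : Type u} [Field K]

/-- Morphisms of symmetric operads: equivariant linear maps preserving the identity and the
compositions. -/
@[ext]
structure Hom (O P : SymmOperad K) where
  app : (n : ℕ) → O.obj n →ₗ[K] P.obj n
  app_map : ∀ {m n : ℕ} (e : Fin m ≃ Fin n) (μ : O.obj m),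
    app n (O.map e μ) = P.map e (app m μ)
  app_one : app 1 O.one = P.one
  app_comp : ∀ {m : ℕ} (k : Fin m → ℕ) (μ : O.obj m) (ν : (i : Fin m) → O.obj (k i)),
    app (∑ i, k i) (O.comp k μ ν) = P.comp k (app m μ) (fun i => app (k i) (ν i))

/-- The composite of two morphisms: first `f`, then `g`. -/
def Hom.trans {O P Q : SymmOperad K} (f : Hom O P) (g : Hom P Q) : Hom O Q where
  app n := (g.app n).comp (f.app n)
  app_map e μ := by simp [f.app_map, g.app_map]
  app_one := by simp [f.app_one, g.app_one]
  app_comp k μ ν := by simp [f.app_comp, g.app_comp]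

/-- `O`, with the morphisms `π₁ : O₁ → O` and `π₂ : O₂ → O`, is a free product `O₁ ∗ O₂`. -/
def IsFreeProduct {O₁ O₂ O : SymmOperad K} (π₁ : Hom O₁ O) (π₂ : Hom O₂ O) : Prop :=
  ∀ (P : SymmOperad K) (ψ₁ : Hom O₁ P) (ψ₂ : Hom O₂ P),
    ∃! ψ : Hom O P, π₁.trans ψ = ψ₁ ∧ π₂.trans ψ = ψ₂

/-- The labels `●` (operations from the first operad) and `∘` (from the second). -/
inductive Label
  | bullet
  | circ

/-- `IsTree π₁ π₂ r n t`: the element `t ∈ O(n)` is the value of a tree with `n` leaves, bijectively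
labelled by `Fin n`, such that every `●`-vertex (`∘`-vertex) has `m ≥ 2` inputs and carries an
element of `O₁(m)` (of `O₂(m)`), and no edge joins two vertices with the same label. Here `r` is
the label of the root, with `r = none` for the trivial tree `id`. -/
inductive IsTree {O₁ O₂ O : SymmOperad K} (π₁ : Hom O₁ O) (π₂ : Hom O₂ O) :
    Option Label → (n : ℕ) → O.obj n → Prop
  | id : IsTree π₁ π₂ none 1 O.one
  | bullet {m n : ℕ} (hm : 2 ≤ m) (k : Fin m → ℕ) (μ : O₁.obj m) (r : Fin m → Option Label)
      (t : (i : Fin m) → O.obj (k i)) (hr : ∀ i, r i ≠ some Label.bullet)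
      (ht : ∀ i, IsTree π₁ π₂ (r i) (k i) (t i)) (e : Fin (∑ i, k i) ≃ Fin n) :
      IsTree π₁ π₂ (some Label.bullet) n (O.map e (O.comp k (π₁.app m μ) t))
  | circ {m n : ℕ} (hm : 2 ≤ m) (k : Fin m → ℕ) (μ : O₂.obj m) (r : Fin m → Option Label)
      (t : (i : Fin m) → O.obj (k i)) (hr : ∀ i, r i ≠ some Label.circ)
      (ht : ∀ i, IsTree π₁ π₂ (r i) (k i) (t i)) (e : Fin (∑ i, k i) ≃ Fin n) :
      IsTree π₁ π₂ (some Label.circ) n (O.map e (O.comp k (π₂.app m μ) t))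

/-- The `●`-part of `O(n)`, for `O = O₁ ∗ O₂`: the span of the trees with a `●`-root, that is, of
the elements `γ(μ; t₁, …, tₘ)^σ` with `m ≥ 2`, `μ ∈ O₁(m)`, `σ` a permutation and each `tᵢ` either
`id` or in the `∘`-part. -/
def bulletPart {O₁ O₂ O : SymmOperad K} (π₁ : Hom O₁ O) (π₂ : Hom O₂ O) (n : ℕ) :
    Submodule K (O.obj n) :=
  Submodule.span K {t | IsTree π₁ π₂ (some Label.bullet) n t}

/-- The `∘`-part of `O(n)`, for `O = O₁ ∗ O₂`: the span of the trees with a `∘`-root. -/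
def circPart {O₁ O₂ O : SymmOperad K} (π₁ : Hom O₁ O) (π₂ : Hom O₂ O) (n : ℕ) :
    Submodule K (O.obj n) :=
  Submodule.span K {t | IsTree π₁ π₂ (some Label.circ) n t}

end SymmOperad

/-! ### Lexicographic order of the inputs of a composite. -/

namespace SymmOperad

/-! Alternating trees span `O(n)` because the factors generate `O`. The difficulty is linear
independence once vertices are decorated by basis elements and the order of the children is fixed.
It is proved by letting `O` act on the space `V` spanned by all decorated planar trees.

For a label `a`, call a tree a generator unless its root has label `a` and arity at least two and
its children form a strictly increasing family of generators. Every tree is then, uniquely, a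
generator or an increasing product of generators (`ofMono_bijective`). This identifies `V` with the
free `P a`-algebra on the generators modulo products with a repeated generator (`squarefree`).
Killing repetitions replaces coinvariants under symmetric groups by a choice of increasing words, in
every characteristic, and costs nothing for expressions in distinct leaves. So `V` is an algebra
over both factors and, by the universal property applied to its endomorphism operad, over `O`
(`IsFreeProduct.exists_alg`).

Evaluate `t ∈ O(n)` at the leaves `0, …, n - 1`. The value lies in the span of the good trees
(alternating, increasing children, each leaf once), and the part of `O(n)` with root label `a` maps
onto the span of the good trees with that root label (`map_part`). Evaluation is injective:
multiplying trees out is an `O`-linear map from `V` to the squarefree free `O`-algebra on `ℕ`, and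
it takes the value of `t` to `t` placed at the word `0, …, n - 1`
(`Generates.evalLeaves_injective`). Hence `O(n)` has a basis indexed by good trees, the root label
gives the splitting, and ranks become cardinalities.

A good tree with root label `a` is a basis operation of some arity `m ≥ 2` with a partition of the
leaves into `m` blocks, each carrying a single leaf or a good tree of the other root label. The
resulting recursion (`mk_good_eq_sum`) is evaluated up to five leaves. -/

theorem finSigmaFinEquiv_val {m : ℕ} (k : Fin m → ℕ) (i : Fin m) (j : Fin (k i)) :
    (finSigmaFinEquiv ⟨i, j⟩ : ℕ) = (∑ i', if i' < i then k i' else 0) + j := by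
  rw [finSigmaFinEquiv_apply]
  congr 1
  rw [← Finset.sum_filter]
  refine Finset.sum_bij (fun x _ => Fin.castLE i.2.le x) ?_ ?_ ?_ ?_
  · intro x _
    simpa using (show Fin.castLE i.2.le x < i from x.2)
  · intro x _ y _ h
    simpa [Fin.ext_iff] using h
  · intro x hx
    simp only [Finset.mem_filter, Finset.mem_univ, true_and] at hx
    exact ⟨⟨x, hx⟩, Finset.mem_univ _, rfl⟩
  · intro x _
    rfl

theorem finSigmaFinEquiv_lt {m : ℕ} (k : Fin m → ℕ) {i i' : Fin m} (h : i < i')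
    (j : Fin (k i)) (j' : Fin (k i')) :
    finSigmaFinEquiv ⟨i, j⟩ < finSigmaFinEquiv ⟨i', j'⟩ := by
  rw [Fin.lt_def, finSigmaFinEquiv_val, finSigmaFinEquiv_val]
  have h1 : (∑ x, if x < i then k x else 0) + k i ≤ ∑ x, if x < i' then k x else 0 := by
    rw [← Finset.sum_filter, ← Finset.sum_filter, add_comm,
      ← Finset.sum_insert (a := i) (f := k) (by simp)]
    apply Finset.sum_le_sum_of_subset
    intro x hx
    simp only [Finset.mem_insert, Finset.mem_filter, Finset.mem_univ, true_and] at hx ⊢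
    rcases hx with rfl | hx
    · exact h
    · exact hx.trans h
  have := j.2
  omega

theorem finSigmaFinEquiv_lt_iff {m : ℕ} (k : Fin m → ℕ) {i i' : Fin m}
    (j : Fin (k i)) (j' : Fin (k i')) :
    finSigmaFinEquiv ⟨i, j⟩ < finSigmaFinEquiv ⟨i', j'⟩ ↔
      i < i' ∨ (i = i' ∧ (j : ℕ) < j') := by
  rcases lt_trichotomy i i' with h | rfl | h
  · simp [h, finSigmaFinEquiv_lt k h]
  · rw [Fin.lt_def, finSigmaFinEquiv_val, finSigmaFinEquiv_val]
    simp
  · simp [h.not_gt, h.ne', (finSigmaFinEquiv_lt k h j' j).le]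

/-- The two iterated lexicographic orders of the leaves of a tree with three levels agree. -/
theorem finSigmaFinEquiv_assoc {m : ℕ} (k : Fin m → ℕ) (l : (i : Fin m) → Fin (k i) → ℕ)
    (p : Fin (∑ i, k i))
    (q : Fin (l (finSigmaFinEquiv.symm p).1 (finSigmaFinEquiv.symm p).2)) :
    finCongr (sum_finSigma k l) (finSigmaFinEquiv ⟨p, q⟩) =
      finSigmaFinEquiv (n := fun i => ∑ j, l i j) ⟨(finSigmaFinEquiv.symm p).1,
        finSigmaFinEquiv ⟨(finSigmaFinEquiv.symm p).2, q⟩⟩ := by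
  apply Fin.ext
  rw [finSigmaFinEquiv_val, finSigmaFinEquiv_val]
  simp only [finCongr_apply, Fin.val_cast]
  rw [finSigmaFinEquiv_val, ← add_assoc]
  congr 1
  obtain ⟨⟨i, j⟩, rfl⟩ := finSigmaFinEquiv.surjective p
  rw [← finSigmaFinEquiv.sum_comp]
  simp only [Equiv.symm_apply_apply]
  rw [Fintype.sum_sigma]
  simp only [finSigmaFinEquiv_lt_iff]
  have h : ∀ x : Fin m, (∑ y : Fin (k x), if x < i ∨ x = i ∧ (y : ℕ) < j then l x y else 0) =
      (if x < i then ∑ y, l x y else 0) +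
        if x = i then ∑ y : Fin (k x), if (y : ℕ) < j then l x y else 0 else 0 := by
    intro x
    rcases lt_trichotomy x i with h | rfl | h
    · simp [h, h.ne]
    · simp
    · simp [h.not_gt, h.ne']
  have h' : ∀ x : Fin m, (∑ y : Fin (k x), if x < i ∨ x = i ∧ (y : ℕ) < j then
      l (finSigmaFinEquiv.symm (finSigmaFinEquiv ⟨x, y⟩)).1
        (finSigmaFinEquiv.symm (finSigmaFinEquiv ⟨x, y⟩)).2 else 0) =
      ∑ y : Fin (k x), if x < i ∨ x = i ∧ (y : ℕ) < j then l x y else 0 := by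
    intro x
    refine Finset.sum_congr rfl fun y _ => ?_
    rw [Equiv.symm_apply_apply]
  rw [Finset.sum_congr rfl fun x _ => (h' x).trans (h x), Finset.sum_add_distrib]
  rw [Equiv.symm_apply_apply]
  simp

theorem finSigmaFinEquiv_one_comp (n : ℕ) (j : Fin n) :
    finSigmaFinEquiv (n := fun _ : Fin 1 => n) ⟨0, j⟩ = finCongr (by simp) j := by
  apply Fin.ext
  rw [finSigmaFinEquiv_val]
  simp

theorem finSigmaFinEquiv_comp_one (n : ℕ) (i : Fin n) :
    finSigmaFinEquiv (n := fun _ : Fin n => 1) ⟨i, 0⟩ = finCongr (by simp) i := by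
  apply Fin.ext
  rw [finSigmaFinEquiv_val, ← Finset.sum_filter]
  have : (Finset.univ.filter fun i' => i' < i) = Finset.Iio i := by
    ext
    simp
  simp [this]

/-! ### Endomorphism operads, generation of free products, algebras. -/

variable {K : Type u} [Field K]

/-- The `n`-ary operations on a vector space, replaced by `0` for `n = 0`. -/
def endObj (V : Type u) [AddCommGroup V] [Module K V] (n : ℕ) :
    Submodule K (MultilinearMap K (fun _ : Fin n => V) V) where
  carrier := {f | n = 0 → f = 0}
  add_mem' ha hb h := by rw [ha h, hb h, add_zero]
  zero_mem' _ := rfl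
  smul_mem' c x hx h := by rw [hx h, smul_zero]

/-- The endomorphism operad of a vector space, with the component in arity `0` replaced by `0`. -/
noncomputable def endOperad (V : Type u) [AddCommGroup V] [Module K V] : SymmOperad K where
  obj n := endObj (K := K) V n
  obj_zero := ⟨fun a b => Subtype.ext ((a.2 rfl).trans (b.2 rfl).symm)⟩
  map {m n} e :=
    { toFun := fun f => ⟨f.1.domDomCongr e, fun h => by
        have : m = 0 := by
          have := Fintype.card_congr e
          simp only [Fintype.card_fin] at this
          omega
        rw [f.2 this]
        rfl⟩
      map_add' := fun _ _ => rfl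
      map_smul' := fun _ _ => rfl }
  map_refl _ _ := rfl
  map_trans _ _ _ := rfl
  one := ⟨MultilinearMap.ofSubsingleton K V V 0 LinearMap.id, fun h => absurd h one_ne_zero⟩
  comp {m} k :=
    { toFun := fun f =>
        { toFun := fun g => ⟨(f.1.compMultilinearMap fun i => (g i).1).domDomCongr
              finSigmaFinEquiv, fun h => by
            ext v
            rcases Nat.eq_zero_or_pos m with hm | hm
            · rw [f.2 hm]
              rfl
            -- A nullary composite of an operation of positive arity has a nullary argument, which
            -- is zero by convention, so multilinearity kills it.
            · have h0 : k ⟨0, hm⟩ = 0 := (Finset.sum_eq_zero_iff.1 h) _ (Finset.mem_univ _)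
              simp only [MultilinearMap.domDomCongr_apply, MultilinearMap.compMultilinearMap_apply]
              refine f.1.map_coord_zero ⟨0, hm⟩ ?_
              rw [(g ⟨0, hm⟩).2 h0]
              rfl⟩
          map_update_add' := fun g i x y => by
            apply Subtype.ext
            ext v
            simp only [MultilinearMap.domDomCongr_apply, MultilinearMap.compMultilinearMap_apply,
              Submodule.coe_add, add_apply]
            convert f.1.map_update_add (fun i' => (g i').1 fun j => v (finSigmaFinEquiv ⟨i', j⟩)) i
              (x.1 fun j => v (finSigmaFinEquiv ⟨i, j⟩))
              (y.1 fun j => v (finSigmaFinEquiv ⟨i, j⟩)) using 2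
            all_goals
              try congr 1
              ext i'
              by_cases h : i' = i
              · subst h
                simp
                try rfl
              · simp [h]
                rfl
          map_update_smul' := fun g i c x => by
            apply Subtype.ext
            ext v
            simp only [MultilinearMap.domDomCongr_apply, MultilinearMap.compMultilinearMap_apply,
              Submodule.coe_smul, smul_apply]
            convert f.1.map_update_smul (fun i' => (g i').1 fun j => v (finSigmaFinEquiv ⟨i', j⟩)) i
              c (x.1 fun j => v (finSigmaFinEquiv ⟨i, j⟩)) using 2
            all_goals
              try congr 1
              ext i'
              by_cases h : i' = i
              · subst h
                simp
                try rfl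
              · simp [h]
                rfl }
      map_add' := fun _ _ => rfl
      map_smul' := fun _ _ => rfl }
  one_comp n μ := by
    apply Subtype.ext
    ext v
    change μ.1 (fun j => v (finSigmaFinEquiv (n := fun _ : Fin 1 => n) ⟨0, j⟩)) = μ.1 (fun j => v (finCongr (by simp) j))
    congr 1
    ext j
    rw [finSigmaFinEquiv_one_comp]
  comp_one n μ := by
    apply Subtype.ext
    ext v
    change μ.1 (fun j => v (finSigmaFinEquiv (n := fun _ : Fin n => 1) ⟨j, 0⟩)) = μ.1 (fun j => v (finCongr (by simp) j))
    congr 1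
    ext j
    rw [finSigmaFinEquiv_comp_one]
  assoc k l μ ν ξ := by
    apply Subtype.ext
    ext v
    change μ.1 (fun i => (ν i).1 fun j =>
      (ξ (finSigmaFinEquiv.symm (finSigmaFinEquiv ⟨i, j⟩)).1
        (finSigmaFinEquiv.symm (finSigmaFinEquiv ⟨i, j⟩)).2).1 fun q =>
        v (finCongr (sum_finSigma k l) (finSigmaFinEquiv ⟨finSigmaFinEquiv ⟨i, j⟩, q⟩))) =
      μ.1 (fun i => (ν i).1 fun j => (ξ i j).1 fun q =>
        v (finSigmaFinEquiv (n := fun i => ∑ j, l i j) ⟨i, finSigmaFinEquiv ⟨j, q⟩⟩))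
    congr 1
    ext i
    congr 1
    ext j
    have h : ∀ p : Fin (∑ i, k i), ((ξ (finSigmaFinEquiv.symm p).1
        (finSigmaFinEquiv.symm p).2).1 fun q =>
        v (finCongr (sum_finSigma k l) (finSigmaFinEquiv ⟨p, q⟩))) =
        (ξ (finSigmaFinEquiv.symm p).1 (finSigmaFinEquiv.symm p).2).1 fun q =>
        v (finSigmaFinEquiv (n := fun i => ∑ j, l i j) ⟨(finSigmaFinEquiv.symm p).1,
        finSigmaFinEquiv ⟨(finSigmaFinEquiv.symm p).2, q⟩⟩) := by
      intro p
      congr 1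
      ext q
      rw [finSigmaFinEquiv_assoc]
    rw [h, Equiv.symm_apply_apply]
  comp_map_left σ k μ ν := by
    apply Subtype.ext
    ext v
    change μ.1 (fun i => (ν (σ i)).1 fun j => v (finSigmaFinEquiv ⟨σ i, j⟩)) =
      μ.1 fun i => (ν (σ i)).1 fun j => v (finSigmaFinEquiv ((Equiv.sigmaCongrLeft
        (β := fun i => Fin (k i)) σ) (finSigmaFinEquiv.symm
        (finSigmaFinEquiv (n := fun i => k (σ i)) ⟨i, j⟩))))
    congr 1
    ext i
    congr 1
    ext j
    rw [Equiv.symm_apply_apply]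
    rfl
  comp_map_right k k' τ μ ν := by
    apply Subtype.ext
    ext v
    change μ.1 (fun i => (ν i).1 fun j => v (finSigmaFinEquiv ⟨i, τ i j⟩)) =
      μ.1 fun i => (ν i).1 fun j => v (finSigmaFinEquiv ((Equiv.sigmaCongrRight τ)
        (finSigmaFinEquiv.symm (finSigmaFinEquiv (n := k) ⟨i, j⟩))))
    congr 1
    ext i
    congr 1
    ext j
    rw [Equiv.symm_apply_apply]
    rfl

/-- A family of submodules closed under the operations of an operad is an operad. -/
def suboperad (O : SymmOperad K) (Q : (n : ℕ) → Submodule K (O.obj n))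
    (hmap : ∀ {m n : ℕ} (e : Fin m ≃ Fin n) (μ : O.obj m), μ ∈ Q m → O.map e μ ∈ Q n)
    (hone : O.one ∈ Q 1)
    (hcomp : ∀ {m : ℕ} (k : Fin m → ℕ) (μ : O.obj m) (ν : (i : Fin m) → O.obj (k i)),
      μ ∈ Q m → (∀ i, ν i ∈ Q (k i)) → O.comp k μ ν ∈ Q (∑ i, k i)) : SymmOperad K where
  obj n := Q n
  obj_zero := ⟨fun a b => Subtype.ext (O.obj_zero.elim a.1 b.1)⟩
  map e := (O.map e).restrict fun μ hμ => hmap e μ hμ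
  map_refl n μ := Subtype.ext (O.map_refl n μ.1)
  map_trans e f μ := Subtype.ext (O.map_trans e f μ.1)
  one := ⟨O.one, hone⟩
  comp k :=
    { toFun := fun μ => ((O.comp k μ.1).compLinearMap fun i => (Q (k i)).subtype).codRestrict
        (Q (∑ i, k i)) fun ν => hcomp k μ.1 _ μ.2 fun i => (ν i).2
      map_add' := fun μ μ' => by
        ext ν
        simp [MultilinearMap.codRestrict]
      map_smul' := fun c μ => by
        ext ν
        simp [MultilinearMap.codRestrict] }
  one_comp n μ := Subtype.ext (O.one_comp n μ.1)
  comp_one n μ := Subtype.ext (O.comp_one n μ.1)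
  assoc k l μ ν ξ := Subtype.ext (O.assoc k l μ.1 (fun i => (ν i).1) fun i j => (ξ i j).1)
  comp_map_left σ k μ ν := Subtype.ext (O.comp_map_left σ k μ.1 fun i => (ν i).1)
  comp_map_right k k' τ μ ν := Subtype.ext (O.comp_map_right k k' τ μ.1 fun i => (ν i).1)

/-- A free product is generated by the images of its factors. -/
theorem IsFreeProduct.mem_of_closed {O₁ O₂ O : SymmOperad K} {π₁ : Hom O₁ O} {π₂ : Hom O₂ O}
    (hO : IsFreeProduct π₁ π₂) (Q : (n : ℕ) → Submodule K (O.obj n))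
    (hmap : ∀ {m n : ℕ} (e : Fin m ≃ Fin n) (μ : O.obj m), μ ∈ Q m → O.map e μ ∈ Q n)
    (hone : O.one ∈ Q 1)
    (hcomp : ∀ {m : ℕ} (k : Fin m → ℕ) (μ : O.obj m) (ν : (i : Fin m) → O.obj (k i)),
      μ ∈ Q m → (∀ i, ν i ∈ Q (k i)) → O.comp k μ ν ∈ Q (∑ i, k i))
    (h₁ : ∀ n μ, π₁.app n μ ∈ Q n) (h₂ : ∀ n μ, π₂.app n μ ∈ Q n) (n : ℕ) (t : O.obj n) :
    t ∈ Q n := by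
  let R := suboperad O Q hmap hone hcomp
  let ψ₁ : Hom O₁ R :=
    { app := fun n => (π₁.app n).codRestrict (Q n) (h₁ n)
      app_map := fun e μ => Subtype.ext (π₁.app_map e μ)
      app_one := Subtype.ext π₁.app_one
      app_comp := fun k μ ν => Subtype.ext (π₁.app_comp k μ ν) }
  let ψ₂ : Hom O₂ R :=
    { app := fun n => (π₂.app n).codRestrict (Q n) (h₂ n)
      app_map := fun e μ => Subtype.ext (π₂.app_map e μ)
      app_one := Subtype.ext π₂.app_one
      app_comp := fun k μ ν => Subtype.ext (π₂.app_comp k μ ν) }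
  let ι : Hom R O :=
    { app := fun n => (Q n).subtype
      app_map := fun _ _ => rfl
      app_one := rfl
      app_comp := fun _ _ _ => rfl }
  let id : Hom O O :=
    { app := fun n => LinearMap.id
      app_map := fun _ _ => rfl
      app_one := rfl
      app_comp := fun _ _ _ => rfl }
  obtain ⟨ψ, ⟨e₁, e₂⟩, -⟩ := hO R ψ₁ ψ₂
  -- Both endomorphisms of `O` restrict to `π₁` and `π₂`, so uniqueness makes them equal; hence
  -- every element lies in the image of the inclusion of `Q`.
  have h : ψ.trans ι = id := by
    refine (hO O π₁ π₂).unique ⟨?_, ?_⟩ ⟨rfl, rfl⟩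
    · change (π₁.trans ψ).trans ι = π₁
      rw [e₁]
      rfl
    · change (π₂.trans ψ).trans ι = π₂
      rw [e₂]
      rfl
  have ht : (ψ.trans ι).app n t = t := by
    rw [h]
    rfl
  rw [← ht]
  exact (ψ.app n t).2

/-- An algebra over an operad. -/
structure Alg (P : SymmOperad K) (V : Type*) [AddCommGroup V] [Module K V] where
  act : {m : ℕ} → P.obj m →ₗ[K] MultilinearMap K (fun _ : Fin m => V) V
  act_one : ∀ v : Fin 1 → V, act P.one v = v 0
  act_map : ∀ {m n : ℕ} (e : Fin m ≃ Fin n) (μ : P.obj m) (v : Fin n → V),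
    act (P.map e μ) v = act μ fun i => v (e i)
  act_comp : ∀ {m : ℕ} (k : Fin m → ℕ) (μ : P.obj m) (ν : (i : Fin m) → P.obj (k i))
    (v : Fin (∑ i, k i) → V),
    act (P.comp k μ ν) v = act μ fun i => act (ν i) fun j => v (finSigmaFinEquiv ⟨i, j⟩)

namespace Alg

variable {P : SymmOperad K} {V : Type u} [AddCommGroup V] [Module K V]

/-- The morphism to the endomorphism operad given by an algebra. -/
noncomputable def toHom (A : Alg P V) : Hom P (endOperad (K := K) V) where
  app n := A.act.codRestrict (endObj V n) fun μ h => by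
    subst h
    rw [P.obj_zero.elim μ 0, map_zero]
  app_map e μ := Subtype.ext (MultilinearMap.ext fun v => A.act_map e μ v)
  app_one := Subtype.ext (MultilinearMap.ext fun v => A.act_one v)
  app_comp k μ ν := Subtype.ext (MultilinearMap.ext fun v => A.act_comp k μ ν v)

/-- The algebra given by a morphism to the endomorphism operad. -/
noncomputable def ofHom (f : Hom P (endOperad (K := K) V)) : Alg P V where
  act {m} := (endObj V m).subtype.comp (f.app m)
  act_one v := by
    change (endObj V 1).subtype (f.app 1 P.one) v = _
    rw [f.app_one]
    rfl
  act_map e μ v := by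
    change (endObj V _).subtype (f.app _ (P.map e μ)) v = _
    rw [f.app_map]
    rfl
  act_comp k μ ν v := by
    change (endObj V _).subtype (f.app _ (P.comp k μ ν)) v = _
    rw [f.app_comp]
    rfl

end Alg

/-- Algebra structures for both factors make up an algebra over the free product. -/
theorem IsFreeProduct.exists_alg {O₁ O₂ O : SymmOperad K} {π₁ : Hom O₁ O} {π₂ : Hom O₂ O}
    (hO : IsFreeProduct π₁ π₂) {V : Type u} [AddCommGroup V] [Module K V]
    (A₁ : Alg O₁ V) (A₂ : Alg O₂ V) : ∃ A : Alg O V,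
      (∀ m (μ : O₁.obj m), A.act (π₁.app m μ) = A₁.act μ) ∧
        ∀ m (μ : O₂.obj m), A.act (π₂.app m μ) = A₂.act μ := by
  obtain ⟨ψ, ⟨e₁, e₂⟩, -⟩ := hO _ A₁.toHom A₂.toHom
  refine ⟨Alg.ofHom ψ, fun m μ => ?_, fun m μ => ?_⟩
  · change (endObj V _).subtype ((π₁.trans ψ).app m μ) = _
    rw [e₁]
    rfl
  · change (endObj V _).subtype ((π₂.trans ψ).app m μ) = _
    rw [e₂]
    rfl

end SymmOperad

/-! ### Multilinear maps on spanning sets. -/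

theorem MultilinearMap.apply_mem_of_mem_span {R ι N : Type*} {M : ι → Type*} [CommRing R] [Finite ι]
    [∀ i, AddCommGroup (M i)] [∀ i, Module R (M i)] [AddCommGroup N] [Module R N]
    (f : MultilinearMap R M N) (S : ∀ i, Set (M i)) (Q : Submodule R N)
    (h : ∀ v, (∀ i, v i ∈ S i) → f v ∈ Q) (v : ∀ i, M i)
    (hv : ∀ i, v i ∈ Submodule.span R (S i)) : f v ∈ Q := by
  classical
  have := Fintype.ofFinite ι
  -- Induction on the set `t` of positions whose arguments may be arbitrary elements of the spans;
  -- outside `t` they belong to the spanning sets.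
  suffices H : ∀ t : Finset ι, ∀ v : ∀ i, M i, (∀ i, v i ∈ Submodule.span R (S i)) →
      (∀ i, i ∉ t → v i ∈ S i) → f v ∈ Q from
    H Finset.univ v hv fun i hi => absurd (Finset.mem_univ i) hi
  intro t
  induction t using Finset.induction_on with
  | empty => exact fun v _ hv => h v fun i => hv i (Finset.notMem_empty i)
  | insert a t ha ih =>
    intro v hv hv'
    have key : ∀ x ∈ Submodule.span R (S a), f (Function.update v a x) ∈ Q := by
      intro x hx
      induction hx using Submodule.span_induction with
      | mem x hx =>
        refine ih _ (fun i => ?_) fun i hi => ?_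
        · by_cases hia : i = a
          · subst hia
            simpa using Submodule.subset_span hx
          · simpa [hia] using hv i
        · by_cases hia : i = a
          · subst hia
            simpa using hx
          · simpa [hia] using hv' i (by simp [hia, hi])
      | zero => simp
      | add x y _ _ hx hy =>
        rw [f.map_update_add]
        exact Q.add_mem hx hy
      | smul c x _ hx =>
        rw [f.map_update_smul]
        exact Q.smul_mem c hx
    simpa using key (v a) (hv a)

theorem MultilinearMap.eq_of_mem_span {R ι N : Type*} {M : ι → Type*} [CommRing R] [Finite ι]
    [∀ i, AddCommGroup (M i)] [∀ i, Module R (M i)] [AddCommGroup N] [Module R N]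
    (f g : MultilinearMap R M N) (S : ∀ i, Set (M i))
    (h : ∀ v, (∀ i, v i ∈ S i) → f v = g v) (v : ∀ i, M i)
    (hv : ∀ i, v i ∈ Submodule.span R (S i)) : f v = g v := by
  have := (f - g).apply_mem_of_mem_span S ⊥ (fun v hv => by simp [h v hv]) v hv
  simpa [sub_eq_zero] using this

theorem MultilinearMap.eq_comp_of_mem_span {R V : Type*} [CommRing R] [AddCommGroup V] [Module R V]
    {m : ℕ} {k : Fin m → ℕ} (f : MultilinearMap R (fun _ : Fin (∑ i, k i) => V) V)
    (g : MultilinearMap R (fun _ : Fin m => V) V)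
    (h : (i : Fin m) → MultilinearMap R (fun _ : Fin (k i) => V) V) (S : Set V)
    (H : ∀ v, (∀ i, v i ∈ S) → f v = g fun i => h i fun j => v (finSigmaFinEquiv ⟨i, j⟩))
    (v : Fin (∑ i, k i) → V) (hv : ∀ i, v i ∈ Submodule.span R S) :
    f v = g fun i => h i fun j => v (finSigmaFinEquiv ⟨i, j⟩) :=
  f.eq_of_mem_span ((g.compMultilinearMap h).domDomCongr finSigmaFinEquiv) (fun _ => S) H v hv

/-! ### The free algebra modulo repeated generators. -/

namespace SymmOperad

open Function

theorem exists_strictMono_comp_sort {n : ℕ} {W : Type*} [LinearOrder W] {w : Fin n → W}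
    (hw : Injective w) : StrictMono (w ∘ Tuple.sort w) :=
  (Tuple.monotone_sort w).strictMono_of_injective (hw.comp (Tuple.sort w).injective)

variable {K : Type u} [Field K] (P : SymmOperad K) (W : Type*)

/-- Words in an alphabet, indexing the summands of the free nonsymmetric algebra. -/
abbrev Word := Σ m : ℕ, (Fin m → W)

variable {W} in
/-- Concatenation of words. -/
def concat {m : ℕ} {k : Fin m → ℕ} (w : (i : Fin m) → Fin (k i) → W) : Fin (∑ i, k i) → W :=
  fun q => w (finSigmaFinEquiv.symm q).1 (finSigmaFinEquiv.symm q).2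

variable {W} in
theorem concat_apply {m : ℕ} {k : Fin m → ℕ} (w : (i : Fin m) → Fin (k i) → W) (i : Fin m)
    (j : Fin (k i)) : concat w (finSigmaFinEquiv ⟨i, j⟩) = w i j := by
  rw [concat, Equiv.symm_apply_apply]

variable {W} in
theorem concat_not_injective {m : ℕ} {k : Fin m → ℕ} {w : (i : Fin m) → Fin (k i) → W} {i : Fin m}
    (h : ¬ Injective (w i)) : ¬ Injective (concat w) := by
  intro h'
  apply h
  intro a b hab
  have := @h' (finSigmaFinEquiv ⟨i, a⟩) (finSigmaFinEquiv ⟨i, b⟩) (by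
    rwa [concat_apply, concat_apply])
  have := finSigmaFinEquiv.injective this
  simpa using this

/-- The direct sum of copies of `P(m)`, one for each word of length `m`. -/
abbrev WordSum := Π₀ p : Word W, P.obj p.1

variable {P W} in
open Classical in
/-- An operation, placed at a word. -/
noncomputable def atWord {m : ℕ} (w : Fin m → W) : P.obj m →ₗ[K] WordSum P W :=
  DFinsupp.lsingle (M := fun p : Word W => P.obj p.1) ⟨m, w⟩

open Classical in
/-- The linear map out of `WordSum P W` with given components. -/
noncomputable def wordLift {N : Type*} [AddCommGroup N] [Module K N]
    (f : {m : ℕ} → (Fin m → W) → P.obj m →ₗ[K] N) : WordSum P W →ₗ[K] N :=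
  DFinsupp.lsum ℕ (M := fun p : Word W => P.obj p.1) fun p => f p.2

variable {P W} in
theorem wordLift_atWord {N : Type*} [AddCommGroup N] [Module K N]
    (f : {m : ℕ} → (Fin m → W) → P.obj m →ₗ[K] N) {m : ℕ} (w : Fin m → W) (μ : P.obj m) :
    wordLift P W f (atWord w μ) = f w μ := by
  classical
  exact DFinsupp.lsum_single ℕ (M := fun p : Word W => P.obj p.1) (fun p => f p.2) ⟨m, w⟩ μ

open Classical in
/-- The composition of operations together with the concatenation of words. -/
noncomputable def wordAct {m : ℕ} :
    P.obj m →ₗ[K] MultilinearMap K (fun _ : Fin m => WordSum P W) (WordSum P W) :=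
  (LinearMap.compMultilinearMapₗ K (DFinsupp.lsum ℕ fun p : Fin m → Word W =>
      (atWord (concat fun i => (p i).2)))) ∘ₗ
    (MultilinearMap.dfinsuppFamilyₗ (κ := fun _ : Fin m => Word W)
      (M := fun _ (p : Word W) => P.obj p.1) (N := fun p => P.obj (∑ i, (p i).1)) (R := K)) ∘ₗ
    (LinearMap.pi fun p => P.comp fun i => (p i).1)

theorem wordAct_atWord {m : ℕ} (μ : P.obj m) (k : Fin m → ℕ) (w : (i : Fin m) → Fin (k i) → W)
    (ν : (i : Fin m) → P.obj (k i)) :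
    wordAct P W μ (fun i => atWord (w i) (ν i)) = atWord (concat w) (P.comp k μ ν) := by
  classical
  have h := MultilinearMap.dfinsuppFamily_single (κ := fun _ : Fin m => Word W) (R := K)
    (M := fun _ (p : Word W) => P.obj p.1) (N := fun p => P.obj (∑ i, (p i).1))
    (fun p => P.comp (fun i => (p i).1) μ) (fun i => ⟨k i, w i⟩) ν
  have h' := DFinsupp.lsum_single ℕ (M := fun p : Fin m → Word W => P.obj (∑ i, (p i).1))
    (fun p => atWord (P := P) (concat fun i => (p i).2)) (fun i => ⟨k i, w i⟩) (P.comp k μ ν)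
  rw [← h] at h'
  exact h'

variable [LinearOrder W]

/-- Strictly increasing words. -/
abbrev MonoWord := Σ m : ℕ, {w : Fin m → W // StrictMono w}

/-- The underlying space of the free `P`-algebra on `W` modulo the products with a repeated
generator. -/
abbrev Squarefree := Π₀ j : MonoWord W, P.obj j.1

variable {P W} in
open Classical in
/-- An operation, placed at a strictly increasing word. -/
noncomputable def atMonoWord {m : ℕ} (w : Fin m → W) (h : StrictMono w) :
    P.obj m →ₗ[K] Squarefree P W :=
  DFinsupp.lsingle (M := fun j : MonoWord W => P.obj j.1) ⟨m, w, h⟩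

open Classical in
/-- The value of an operation on generators. -/
noncomputable def word {m : ℕ} (w : Fin m → W) : P.obj m →ₗ[K] Squarefree P W :=
  if h : Injective w then
    atMonoWord (w ∘ Tuple.sort w) (exists_strictMono_comp_sort h) ∘ₗ P.map (Tuple.sort w).symm
  else 0

variable {P W}

theorem word_of_not_injective {m : ℕ} {w : Fin m → W} (h : ¬ Injective w) (μ : P.obj m) :
    word P W w μ = 0 := by
  rw [word, dif_neg h]
  rfl

theorem atMonoWord_congr {m : ℕ} {w w' : Fin m → W} (e : w = w') (h : StrictMono w)
    (h' : StrictMono w') (μ : P.obj m) : atMonoWord w h μ = atMonoWord w' h' μ := by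
  subst e
  rfl

theorem word_of_strictMono {m : ℕ} {w : Fin m → W} (h : StrictMono w) (μ : P.obj m) :
    word P W w μ = atMonoWord w h μ := by
  have hs : Tuple.sort w = Equiv.refl _ := Tuple.sort_eq_refl_iff_monotone.2 h.monotone
  rw [word, dif_pos h.injective, LinearMap.comp_apply,
    atMonoWord_congr (w' := w) (by rw [hs]; rfl) _ h]
  rw [hs, Equiv.refl_symm, P.map_refl]

/-- This is the coinvariance relation of a free algebra, obtained without a quotient. The words `w`
and `w ∘ e` sort to the same increasing word, and for injective `w` the sorting permutation is
unique, so the two sorting permutations differ exactly by `e`. -/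
theorem word_map {m n : ℕ} (e : Fin m ≃ Fin n) (w : Fin n → W) (μ : P.obj m) :
    word P W w (P.map e μ) = word P W (w ∘ e) μ := by
  classical
  have hmn : m = n := by simpa using Fintype.card_congr e
  subst hmn
  by_cases h : Injective w
  · have h' : Injective (w ∘ e) := h.comp e.injective
    have hs : (w ∘ e) ∘ Tuple.sort (w ∘ e) = w ∘ Tuple.sort w :=
      Tuple.comp_perm_comp_sort_eq_comp_sort
    have hs' : (Tuple.sort (w ∘ e)).symm = e.trans (Tuple.sort w).symm := by
      ext i
      congr 1
      apply (Tuple.sort (w ∘ e)).injective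
      rw [Equiv.apply_symm_apply]
      apply e.injective
      apply h
      have := congrFun hs ((Tuple.sort w).symm (e i))
      simpa using this.symm
    rw [word, word, dif_pos h, dif_pos h', LinearMap.comp_apply, LinearMap.comp_apply,
      hs', P.map_trans, atMonoWord_congr hs _ (exists_strictMono_comp_sort h)]
  · have h' : ¬ Injective (w ∘ e) := fun h' => h (by simpa using h')
    rw [word_of_not_injective h, word_of_not_injective h']

theorem word_eq_word_sort {m : ℕ} (w : Fin m → W) (μ : P.obj m) :
    word P W w μ = word P W (w ∘ Tuple.sort w) (P.map (Tuple.sort w).symm μ) := by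
  rw [word_map]
  congr 1
  congr 1
  ext i
  simp

variable (P W)

/-- The normal form of a word. -/
noncomputable def normalize : WordSum P W →ₗ[K] Squarefree P W :=
  wordLift P W fun w => word P W w

open Classical in
/-- The inclusion of the normal forms. -/
noncomputable def inclusion : Squarefree P W →ₗ[K] WordSum P W :=
  DFinsupp.lsum ℕ (M := fun j : MonoWord W => P.obj j.1) fun j => atWord j.2.1

/-- The operations on `Squarefree P W`. -/
noncomputable def squarefreeAct {m : ℕ} :
    P.obj m →ₗ[K] MultilinearMap K (fun _ : Fin m => Squarefree P W) (Squarefree P W) :=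
  (LinearMap.compMultilinearMapₗ K (normalize P W)) ∘ₗ
    (MultilinearMap.compLinearMapₗ fun _ => inclusion P W) ∘ₗ wordAct P W

variable {P W}

theorem normalize_atWord {m : ℕ} (w : Fin m → W) (μ : P.obj m) :
    normalize P W (atWord w μ) = word P W w μ :=
  wordLift_atWord _ w μ

theorem inclusion_word {m : ℕ} {w : Fin m → W} (h : Injective w) (μ : P.obj m) :
    inclusion P W (word P W w μ) =
      atWord (w ∘ Tuple.sort w) (P.map (Tuple.sort w).symm μ) := by
  classical
  rw [word_eq_word_sort, word_of_strictMono (exists_strictMono_comp_sort h)]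
  exact DFinsupp.lsum_single ℕ (M := fun j : MonoWord W => P.obj j.1) (fun j : MonoWord W => atWord (P := P) j.2.1)
    ⟨m, _, exists_strictMono_comp_sort h⟩ _

/-- The formula from which all algebra axioms follow. Sorting the arguments first only permutes
inputs inside the blocks, and equivariance together with `word_map` absorbs this; a repetition
inside one block is also a repetition in the concatenation. -/
theorem squarefreeAct_word {m : ℕ} (μ : P.obj m) (k : Fin m → ℕ)
    (w : (i : Fin m) → Fin (k i) → W) (ν : (i : Fin m) → P.obj (k i)) :
    squarefreeAct P W μ (fun i => word P W (w i) (ν i)) =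
      word P W (concat w) (P.comp k μ ν) := by
  classical
  by_cases h : ∀ i, Injective (w i)
  · change normalize P W (wordAct P W μ fun i => inclusion P W (word P W (w i) (ν i))) = _
    simp only [inclusion_word (h _)]
    rw [wordAct_atWord, normalize_atWord, P.comp_map_right, word_map]
    congr 1
    congr 1
    ext q
    obtain ⟨⟨i, j⟩, rfl⟩ := finSigmaFinEquiv.surjective q
    simp only [comp_apply, Equiv.trans_apply]
    rw [Equiv.symm_apply_apply, concat_apply]
    rw [concat_apply]
    exact congrArg (w i) (Equiv.apply_symm_apply _ _)
  · push Not at h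
    obtain ⟨i, hi⟩ := h
    rw [word_of_not_injective (concat_not_injective hi)]
    exact (squarefreeAct P W μ).map_coord_zero i (word_of_not_injective hi _)

theorem mem_span_word (v : Squarefree P W) : v ∈ Submodule.span K
    {v | ∃ (m : ℕ) (w : Fin m → W) (μ : P.obj m), v = word P W w μ} := by
  classical
  induction v using DFinsupp.induction with
  | h0 => exact Submodule.zero_mem _
  | ha j b f _ _ hf =>
    refine Submodule.add_mem _ (Submodule.subset_span ⟨j.1, j.2.1, b, ?_⟩) hf
    rw [word_of_strictMono j.2.2]
    rfl

variable (P W)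

theorem squarefreeAct_one (v : Fin 1 → Squarefree P W) : squarefreeAct P W P.one v = v 0 := by
  refine MultilinearMap.eq_of_mem_span (squarefreeAct P W P.one)
    (MultilinearMap.ofSubsingleton K _ _ 0 LinearMap.id) _ ?_ v fun i => mem_span_word _
  intro v hv
  obtain ⟨m, w, μ, h⟩ := hv 0
  obtain rfl : v = fun i => word P W w μ := by
    ext1 i
    rw [Subsingleton.elim i 0, h]
  rw [squarefreeAct_word P.one (fun _ => m) (fun _ => w) fun _ => μ, P.one_comp, word_map]
  change _ = word P W w μ
  congr 1
  congr 1
  ext i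
  rw [comp_apply, ← finSigmaFinEquiv_one_comp, concat_apply]

theorem squarefreeAct_map {m n : ℕ} (e : Fin m ≃ Fin n) (μ : P.obj m)
    (v : Fin n → Squarefree P W) :
    squarefreeAct P W (P.map e μ) v = squarefreeAct P W μ fun i => v (e i) := by
  refine MultilinearMap.eq_of_mem_span (squarefreeAct P W (P.map e μ))
    ((squarefreeAct P W μ).domDomCongr e) _ ?_ v fun i => mem_span_word _
  intro v hv
  choose k w ν hp using hv
  obtain rfl : v = fun i => word P W (w i) (ν i) := funext hp
  rw [squarefreeAct_word, P.comp_map_left, word_map]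
  refine Eq.trans ?_ (squarefreeAct_word μ _ (fun i => w (e i)) fun i => ν (e i)).symm
  congr 1
  congr 1
  ext q
  obtain ⟨⟨i, j⟩, rfl⟩ := finSigmaFinEquiv.surjective q
  simp only [comp_apply, Equiv.trans_apply]
  rw [Equiv.symm_apply_apply, Equiv.sigmaCongrLeft_apply, concat_apply, concat_apply]

theorem squarefreeAct_comp {m : ℕ} (k : Fin m → ℕ) (μ : P.obj m) (ν : (i : Fin m) → P.obj (k i))
    (v : Fin (∑ i, k i) → Squarefree P W) : squarefreeAct P W (P.comp k μ ν) v =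
      squarefreeAct P W μ fun i => squarefreeAct P W (ν i) fun j =>
        v (finSigmaFinEquiv ⟨i, j⟩) := by
  refine MultilinearMap.eq_comp_of_mem_span (squarefreeAct P W (P.comp k μ ν))
    (squarefreeAct P W μ) (fun i => squarefreeAct P W (ν i)) _ ?_ v fun i => mem_span_word _
  intro v hv
  have hv' : ∀ i j, ∃ (l : ℕ) (w : Fin l → W) (μ : P.obj l),
      v (finSigmaFinEquiv ⟨i, j⟩) = word P W w μ := fun i j => hv (finSigmaFinEquiv ⟨i, j⟩)
  choose l w ξ hp using hv'
  have h : v = fun q => word P W (w (finSigmaFinEquiv.symm q).1 (finSigmaFinEquiv.symm q).2)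
      (ξ (finSigmaFinEquiv.symm q).1 (finSigmaFinEquiv.symm q).2) := by
    ext q : 1
    rw [← hp]
    simp
  simp only [hp, squarefreeAct_word]
  rw [h, squarefreeAct_word, ← P.assoc k l μ ν ξ, word_map]
  congr 1
  congr 1
  ext q
  obtain ⟨⟨a, q⟩, rfl⟩ := finSigmaFinEquiv.surjective q
  rw [comp_apply, concat_apply, finSigmaFinEquiv_assoc, concat_apply, concat_apply]

/-- The free `P`-algebra on `W` modulo the products with a repeated generator. -/
noncomputable def squarefree : Alg P (Squarefree P W) where
  act := squarefreeAct P W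
  act_one v := squarefreeAct_one P W v
  act_map e μ v := squarefreeAct_map P W e μ v
  act_comp k μ ν v := squarefreeAct_comp P W k μ ν v

end SymmOperad

/-! ### Algebra structures over both factors on the span of trees. -/

namespace SymmOperad

open Function

variable {K : Type u} [Field K]

theorem squarefree_act_gen {P : SymmOperad K} {W : Type*} [LinearOrder W] {m : ℕ} (μ : P.obj m)
    (w : Fin m → W) :
    (squarefree P W).act μ (fun i => word P W (fun _ : Fin 1 => w i) P.one) = word P W w μ := by
  refine (squarefreeAct_word μ (fun _ => 1) (fun i _ => w i) fun _ => P.one).trans ?_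
  rw [P.comp_one, word_map]
  congr 1
  congr 1
  ext i
  rw [comp_apply, ← finSigmaFinEquiv_comp_one, concat_apply]

/-- Transport of an algebra along a linear equivalence. -/
noncomputable def Alg.transport {P : SymmOperad K} {V V' : Type*} [AddCommGroup V] [Module K V]
    [AddCommGroup V'] [Module K V'] (A : Alg P V) (e : V' ≃ₗ[K] V) : Alg P V' where
  act := (LinearMap.compMultilinearMapₗ K e.symm.toLinearMap) ∘ₗ
    (MultilinearMap.compLinearMapₗ fun _ => e.toLinearMap) ∘ₗ A.act
  act_one v := by
    change e.symm (A.act P.one fun i => e (v i)) = v 0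
    rw [A.act_one, e.symm_apply_apply]
  act_map f μ v := by
    change e.symm (A.act _ fun i => e (v i)) = e.symm (A.act _ fun i => e (v (f i)))
    rw [A.act_map]
  act_comp k μ ν v := by
    change e.symm (A.act _ fun i => e (v i)) =
      e.symm (A.act _ fun i => e (e.symm (A.act _ fun j => e (v (finSigmaFinEquiv ⟨i, j⟩)))))
    rw [A.act_comp]
    simp

theorem Alg.transport_act {P : SymmOperad K} {V V' : Type*} [AddCommGroup V] [Module K V]
    [AddCommGroup V'] [Module K V'] (A : Alg P V) (e : V' ≃ₗ[K] V) {m : ℕ} (μ : P.obj m)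
    (v : Fin m → V') : (A.transport e).act μ v = e.symm (A.act μ fun i => e (v i)) :=
  rfl

/-- Bases of the components of a pair of operads, that in arity `1` being the identity. -/
structure Bases (P : Label → SymmOperad K) where
  ι : Label → ℕ → Type u
  basis : ∀ a m, Module.Basis (ι a m) K ((P a).obj m)
  i₀ : ∀ a, ι a 1
  eq_i₀ : ∀ a i, i = i₀ a
  basis_i₀ : ∀ a, basis a 1 (i₀ a) = (P a).one

theorem one_ne_zero_of_rank_eq_one {P : SymmOperad K} (h : Module.rank K (P.obj 1) = 1) :
    P.one ≠ 0 := by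
  intro h0
  have hz : ∀ μ : P.obj 1, μ = 0 := by
    intro μ
    have h1 := P.one_comp 1 μ
    rw [h0, map_zero] at h1
    have h2 : P.map (finCongr (show ∑ _i : Fin 1, 1 = 1 by simp))
        (P.map (finCongr (show 1 = ∑ _i : Fin 1, 1 by simp)) μ) = μ := by
      rw [← P.map_trans]
      exact P.map_refl 1 μ
    rw [← h2, ← h1]
    simp
  have : Subsingleton (P.obj 1) := ⟨fun a b => by rw [hz a, hz b]⟩
  rw [rank_subsingleton'] at h
  exact zero_ne_one h

theorem exists_bases (P : Label → SymmOperad K)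
    (h : ∀ a, Module.rank K ((P a).obj 1) = 1) : Nonempty (Bases P) := by
  -- The condition on arity `1` is guarded by an equality `1 = m`, so that the bases can be chosen
  -- for all arities at once.
  have H : ∀ a m, ∃ (ι : Type u) (b : Module.Basis ι K ((P a).obj m)), ∀ e : 1 = m,
      ∃ i₀ : ι, (∀ i, i = i₀) ∧ b i₀ = e ▸ (P a).one := by
    intro a m
    by_cases e : 1 = m
    · subst e
      have hf : Module.finrank K ((P a).obj 1) = 1 := by
        rw [Module.finrank, h a]
        simp
      refine ⟨PUnit, Module.Basis.mk (v := fun _ => (P a).one) ?_ ?_, fun _ => ⟨⟨⟩, ?_, ?_⟩⟩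
      · exact LinearIndependent.of_subsingleton PUnit.unit (one_ne_zero_of_rank_eq_one (h a))
      · rw [Set.range_const, ((finrank_eq_one_iff_of_nonzero _
          (one_ne_zero_of_rank_eq_one (h a))).1 hf)]
      · intro i
        rfl
      · simp
    · exact ⟨_, Module.Basis.ofVectorSpace K _, fun e' => absurd e' e⟩
  choose ι b hb using H
  choose i₀ h1 h2 using fun a => hb a 1 rfl
  exact ⟨⟨ι, b, i₀, h1, h2⟩⟩

/-- Planar trees with leaves labelled by natural numbers and decorated vertices. -/
inductive OpTree (ι : Label → ℕ → Type u) : Type u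
  | leaf (l : ℕ) : OpTree ι
  | node (a : Label) (m : ℕ) (i : ι a m) (c : Fin m → OpTree ι) : OpTree ι

namespace OpTree

variable {ι : Label → ℕ → Type u}

/-- An arbitrary linear order of the trees. -/
noncomputable instance : LinearOrder (OpTree ι) :=
  IsWellOrder.linearOrder WellOrderingRel

/-- The trees that are generators for the operad with label `a`: all except for the increasing
products of generators. -/
def IsGen (a : Label) : OpTree ι → Prop
  | leaf _ => True
  | node a' m _ c => ¬ (a' = a ∧ 2 ≤ m ∧ StrictMono c ∧ ∀ i, IsGen a (c i))

/-- The product of increasing generators. -/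
def ofMono (a : Label) : (m : ℕ) → ι a m → (Fin m → {T : OpTree ι // IsGen a T}) → OpTree ι
  | 0, i, c => node a 0 i fun j => (c j).1
  | 1, _, c => (c 0).1
  | m + 2, i, c => node a (m + 2) i fun j => (c j).1

theorem ofMono_of_two_le (a : Label) {m : ℕ} (hm : 2 ≤ m) (i : ι a m)
    (c : Fin m → {T : OpTree ι // IsGen a T}) : ofMono a m i c = node a m i fun j => (c j).1 := by
  obtain ⟨m, rfl⟩ := Nat.exists_eq_add_of_le' hm
  rfl

theorem not_isGen_node {a : Label} {m : ℕ} (hm : 2 ≤ m) (i : ι a m)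
    {c : Fin m → {T : OpTree ι // IsGen a T}} (hc : StrictMono c) :
    ¬ IsGen a (node a m i fun j => (c j).1) := by
  rw [IsGen, not_not]
  exact ⟨rfl, hm, fun _ _ h => hc h, fun j => (c j).2⟩

end OpTree

open OpTree

variable {P : Label → SymmOperad K} (B : Bases P)

instance Bases.isEmpty_zero (a : Label) : IsEmpty (B.ι a 0) := by
  have := (P a).obj_zero
  exact ⟨fun i => (B.basis a 0).ne_zero i (Subsingleton.elim _ _)⟩

/-- There are no basis operations of arity `0`; the only one of arity `1` is the identity and
accounts for the generators; those of arity at least `2` give exactly the trees that `IsGen`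
excludes. A tree thus determines which case it is in, and its root and children. -/
theorem ofMono_bijective (a : Label) : Bijective
    fun x : (Σ j : MonoWord {T : OpTree B.ι // IsGen a T}, B.ι a j.1) => ofMono a x.1.1 x.2 x.1.2.1 := by
  constructor
  · rintro ⟨⟨m, c, hc⟩, i⟩ ⟨⟨m', c', hc'⟩, i'⟩ h
    simp only at h i i'
    match m, m', c, c', i, i' with
    | 0, _, _, _, i, _ => exact isEmptyElim i
    | _, 0, _, _, _, i => exact isEmptyElim i
    | 1, 1, c, c', i, i' =>
      have h : c 0 = c' 0 := Subtype.ext h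
      have : c = c' := funext fun j => by rw [Subsingleton.elim j 0, h]
      subst this
      rw [B.eq_i₀ a i, B.eq_i₀ a i']
    | 1, m + 2, c, c', i, i' =>
      refine absurd (c 0).2 ?_
      rw [show (c 0).1 = node a (m + 2) i' fun j => (c' j).1 from h]
      exact not_isGen_node (by omega) i' hc'
    | m + 2, 1, c, c', i, i' =>
      refine absurd (c' 0).2 ?_
      rw [show (c' 0).1 = node a (m + 2) i fun j => (c j).1 from h.symm]
      exact not_isGen_node (by omega) i hc
    | m + 2, m' + 2, c, c', i, i' =>
      simp only [ofMono, node.injEq, true_and, Nat.add_right_cancel_iff] at h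
      obtain ⟨rfl, hi, hcc⟩ := h
      obtain rfl := eq_of_heq hi
      have : c = c' := funext fun j => Subtype.ext (congrFun (eq_of_heq hcc) j)
      subst this
      rfl
  · intro T
    by_cases h : IsGen a T
    · exact ⟨⟨⟨1, fun _ => ⟨T, h⟩, Subsingleton.strictMono _⟩, B.i₀ a⟩, rfl⟩
    · cases T with
      | leaf l => exact absurd trivial h
      | node a' m i c =>
        rw [IsGen, not_not] at h
        obtain ⟨rfl, hm, hc, hg⟩ := h
        exact ⟨⟨⟨m, fun j => ⟨c j, hg j⟩, fun _ _ h => hc h⟩, i⟩, ofMono_of_two_le _ hm _ _⟩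

/-- The basis of the free algebra indexed by trees. -/
noncomputable def treeBasis (a : Label) :
    Module.Basis (OpTree B.ι) K (Squarefree (P a) {T : OpTree B.ι // IsGen a T}) :=
  (DFinsupp.basis fun j : MonoWord {T : OpTree B.ι // IsGen a T} => B.basis a j.1).reindex
    (Equiv.ofBijective _ (ofMono_bijective B a))

theorem treeBasis_ofMono (a : Label) {m : ℕ} (i : B.ι a m)
    {c : Fin m → {T : OpTree B.ι // IsGen a T}} (hc : StrictMono c) :
    treeBasis B a (ofMono a m i c) = word (P a) _ c (B.basis a m i) := by
  rw [treeBasis, Module.Basis.reindex_apply, word_of_strictMono hc]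
  have : (Equiv.ofBijective _ (ofMono_bijective B a)).symm (ofMono a m i c) = ⟨⟨m, c, hc⟩, i⟩ := by
    rw [Equiv.symm_apply_eq]
    rfl
  rw [this]
  apply (DFinsupp.basis fun j : MonoWord {T : OpTree B.ι // IsGen a T} =>
    B.basis a j.1).repr.injective
  rw [Module.Basis.repr_self]
  classical
  simp only [DFinsupp.basis, atMonoWord, DFinsupp.lsingle_apply, LinearEquiv.trans_apply,
    DFinsupp.mapRange.linearEquiv_apply, DFinsupp.mapRange_single, Module.Basis.repr_self]
  rw [LinearEquiv.eq_symm_apply]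
  exact sigmaFinsuppEquivDFinsupp_single _ _

/-- The algebra structure over the operad with label `a` on the space spanned by the trees. -/
noncomputable def treeAlg (a : Label) : Alg (P a) (OpTree B.ι →₀ K) :=
  (squarefree (P a) {T : OpTree B.ι // IsGen a T}).transport (treeBasis B a).repr.symm

theorem treeAlg_act (a : Label) {m : ℕ} (μ : (P a).obj m)
    (c : Fin m → {T : OpTree B.ι // IsGen a T}) :
    (treeAlg B a).act μ (fun j => Finsupp.single (c j).1 1) =
      (treeBasis B a).repr (word (P a) _ c μ) := by
  have h : ∀ T : {T : OpTree B.ι // IsGen a T}, (treeBasis B a).repr.symm (Finsupp.single T.1 1) =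
      word (P a) _ (fun _ : Fin 1 => T) (P a).one := by
    intro T
    rw [Module.Basis.repr_symm_single_one, ← B.basis_i₀ a,
      ← treeBasis_ofMono B a _ (Subsingleton.strictMono _)]
    rfl
  rw [treeAlg, Alg.transport_act]
  simp only [h, squarefree_act_gen]
  rfl

theorem treeAlg_act_of_not_injective (a : Label) {m : ℕ} (μ : (P a).obj m) {c : Fin m → OpTree B.ι}
    (hg : ∀ j, IsGen a (c j)) (hc : ¬ Injective c) :
    (treeAlg B a).act μ (fun j => Finsupp.single (c j) 1) = 0 := by
  refine (treeAlg_act B a μ fun j => ⟨c j, hg j⟩).trans ?_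
  rw [word_of_not_injective, map_zero]
  exact fun h => hc (Subtype.val_injective.comp h)

/-- On increasing generators the action is plain grafting. All later computations reduce to this
case. -/
theorem treeAlg_act_basis (a : Label) {m : ℕ} (hm : 2 ≤ m) (i : B.ι a m) {c : Fin m → OpTree B.ι}
    (hg : ∀ j, IsGen a (c j)) (hc : StrictMono c) :
    (treeAlg B a).act (B.basis a m i) (fun j => Finsupp.single (c j) 1) =
      Finsupp.single (node a m i c) 1 := by
  refine (treeAlg_act B a _ fun j => ⟨c j, hg j⟩).trans ?_
  rw [← treeBasis_ofMono B a i fun _ _ h => hc h, ofMono_of_two_le a hm, Module.Basis.repr_self]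

end SymmOperad

/-! ### Good trees and evaluation at leaves. -/

namespace SymmOperad

open Function OpTree

variable {K : Type u} [Field K]

namespace OpTree

variable {ι : Label → ℕ → Type u}

/-- `Good r T S`: the vertices of `T` have at least two inputs, no edge joins two vertices with the
same label, the subtrees at each vertex are increasing and have disjoint sets of leaf labels;
`r` is the label of the root and `S` is the set of leaf labels. -/
inductive Good : Option Label → OpTree ι → Finset ℕ → Prop
  | leaf (l : ℕ) : Good none (leaf l) {l}
  | node (a : Label) {m : ℕ} (hm : 2 ≤ m) (i : ι a m) (c : Fin m → OpTree ι)
      (r : Fin m → Option Label) (S : Fin m → Finset ℕ) (hr : ∀ j, r j ≠ some a)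
      (hc : StrictMono c) (hg : ∀ j, Good (r j) (c j) (S j)) (hS : Pairwise (Disjoint on S)) :
      Good (some a) (node a m i c) (Finset.univ.biUnion S)

theorem Good.nonempty {r : Option Label} {T : OpTree ι} {S : Finset ℕ} (h : Good r T S) :
    S.Nonempty := by
  induction h with
  | leaf l => exact Finset.singleton_nonempty l
  | node a hm i c r S hr hc hg hS ih =>
    obtain ⟨x, hx⟩ := ih ⟨0, by omega⟩
    exact ⟨x, Finset.mem_biUnion.2 ⟨_, Finset.mem_univ _, hx⟩⟩

theorem Good.isGen {r : Option Label} {T : OpTree ι} {S : Finset ℕ} (h : Good r T S) {a : Label}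
    (hr : r ≠ some a) : IsGen a T := by
  cases h with
  | leaf l => trivial
  | node a' =>
    rw [IsGen]
    rintro ⟨rfl, -⟩
    exact hr rfl

theorem Good.unique {r r' : Option Label} {T : OpTree ι} {S S' : Finset ℕ} (h : Good r T S)
    (h' : Good r' T S') : r = r' ∧ S = S' := by
  induction h generalizing r' S' with
  | leaf l =>
    cases h'
    exact ⟨rfl, rfl⟩
  | node a hm i c r S hr hc hg hS ih =>
    cases h' with
    | node _ _ _ _ r' S' hr' hc' hg' hS' =>
      obtain rfl : S = S' := funext fun j => (ih j (hg' j)).2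
      exact ⟨rfl, rfl⟩

theorem injective_of_good {m : ℕ} {r : Fin m → Option Label} {c : Fin m → OpTree ι}
    {S : Fin m → Finset ℕ} (hg : ∀ j, Good (r j) (c j) (S j)) (hS : Pairwise (Disjoint on S)) :
    Injective c := by
  intro j j' h
  by_contra hj
  have h1 := ((hg j).unique (h ▸ hg j')).2
  have h2 : Disjoint (S j) (S j') := hS hj
  rw [← h1, disjoint_self] at h2
  exact (hg j).nonempty.ne_empty h2

end OpTree

variable {P : Label → SymmOperad K} (B : Bases P)

/-- The basis vector of a tree. -/
noncomputable abbrev single {ι : Label → ℕ → Type u} (T : OpTree ι) : OpTree ι →₀ K :=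
  Finsupp.single T 1

variable (K) in
/-- The span of the trees with given properties. -/
noncomputable def goodSpan {ι : Label → ℕ → Type u} (R : Set (Option Label)) (S : Finset ℕ) :
    Submodule K (OpTree ι →₀ K) :=
  Submodule.span K {v | ∃ r T, r ∈ R ∧ Good r T S ∧ v = single T}

theorem single_mem_goodSpan {ι : Label → ℕ → Type u} {R : Set (Option Label)} {r : Option Label}
    {T : OpTree ι} {S : Finset ℕ} (h : Good r T S) (hr : r ∈ R) : single T ∈ goodSpan K R S :=
  Submodule.subset_span ⟨r, T, hr, h, rfl⟩

theorem goodSpan_mono {ι : Label → ℕ → Type u} {R R' : Set (Option Label)} (h : R ⊆ R')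
    (S : Finset ℕ) : goodSpan K (ι := ι) R S ≤ goodSpan K R' S :=
  Submodule.span_mono fun _ ⟨r, T, hr, hg⟩ => ⟨r, T, h hr, hg⟩

theorem Alg.act_sort {Q : SymmOperad K} {V : Type*} [AddCommGroup V] [Module K V] (A : Alg Q V)
    {m : ℕ} (σ : Equiv.Perm (Fin m)) (μ : Q.obj m) (v : Fin m → V) :
    A.act (Q.map σ.symm μ) (v ∘ σ) = A.act μ v := by
  rw [A.act_map]
  simp

/-- Children with disjoint nonempty leaf sets are distinct, so they can be sorted at the cost of
permuting the operation. Expanding the permuted operation in the basis then gives grafted trees,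
which are good. -/
theorem act_mem_goodSpan_of_two_le (a : Label) {m : ℕ} (hm : 2 ≤ m) (μ : (P a).obj m)
    {r : Fin m → Option Label} {c : Fin m → OpTree B.ι} {S : Fin m → Finset ℕ}
    (hr : ∀ j, r j ≠ some a) (hg : ∀ j, Good (r j) (c j) (S j)) (hS : Pairwise (Disjoint on S)) :
    (treeAlg B a).act μ (fun j => single (c j)) ∈ goodSpan K {some a} (Finset.univ.biUnion S) := by
  have hc := exists_strictMono_comp_sort (injective_of_good hg hS)
  rw [← (treeAlg B a).act_sort (Tuple.sort c)]
  generalize (P a).map (Tuple.sort c).symm μ = μ'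
  have hμ : μ' ∈ Submodule.span K (Set.range (B.basis a m)) := by
    rw [(B.basis a m).span_eq]
    trivial
  induction hμ using Submodule.span_induction with
  | mem x hx =>
    obtain ⟨i, rfl⟩ := hx
    have := Good.node a hm i _ (r ∘ Tuple.sort c) (S ∘ Tuple.sort c) (fun j => hr _) hc
      (fun j => hg _) (hS.comp_of_injective (Tuple.sort c).injective)
    have hu : Finset.univ.biUnion (S ∘ Tuple.sort c) = Finset.univ.biUnion S := by
      ext x
      simp only [Finset.mem_biUnion, Finset.mem_univ, true_and, comp_apply]
      exact (Tuple.sort c).exists_congr_left.trans (by simp)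
    rw [hu] at this
    have h2 := treeAlg_act_basis B a hm i (fun j => (hg (Tuple.sort c j)).isGen (hr _)) hc
    have h3 := single_mem_goodSpan (K := K) this (Set.mem_singleton _)
    exact (congrArg (· ∈ _) h2).mpr h3
  | zero => simp
  | add x y _ _ hx hy =>
    rw [map_add]
    exact Submodule.add_mem _ hx hy
  | smul k x _ hx =>
    rw [map_smul]
    exact Submodule.smul_mem _ k hx

theorem Bases.exists_smul_one (B : Bases P) (a : Label) (μ : (P a).obj 1) : ∃ k : K, μ = k • (P a).one := by
  refine ⟨(B.basis a 1).repr μ (B.i₀ a), ?_⟩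
  rw [← B.basis_i₀ a]
  apply (B.basis a 1).ext_elem
  intro i
  rw [B.eq_i₀ a i]
  simp

theorem act_mem_goodSpan_gen (a : Label) {m : ℕ} (μ : (P a).obj m)
    {r : Fin m → Option Label} {c : Fin m → OpTree B.ι} {S : Fin m → Finset ℕ}
    (hr : ∀ j, r j ≠ some a) (hg : ∀ j, Good (r j) (c j) (S j)) (hS : Pairwise (Disjoint on S)) :
    (treeAlg B a).act μ (fun j => single (c j)) ∈
      goodSpan K Set.univ (Finset.univ.biUnion S) := by
  match m with
  | 0 =>
    rw [(P a).obj_zero.elim μ 0]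
    simp
  | 1 =>
    obtain ⟨k, rfl⟩ := B.exists_smul_one a μ
    rw [map_smul, smul_apply, (treeAlg B a).act_one]
    refine Submodule.smul_mem _ _ (single_mem_goodSpan (r := r 0) ?_ trivial)
    simpa using hg 0
  | m + 2 =>
    exact goodSpan_mono (Set.subset_univ _) _
      (act_mem_goodSpan_of_two_le B a (by omega) μ hr hg hS)

/-- If the root has label `a`, take its operation and children; otherwise apply the identity to the
tree itself. Either way the arguments are generators for `a`. -/
theorem OpTree.Good.exists_act_eq (a : Label) {r : Option Label} {T : OpTree B.ι} {S : Finset ℕ}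
    (h : Good r T S) : ∃ (m : ℕ) (μ : (P a).obj m) (r' : Fin m → Option Label)
      (c : Fin m → OpTree B.ι) (S' : Fin m → Finset ℕ), (∀ j, r' j ≠ some a) ∧
      (∀ j, Good (r' j) (c j) (S' j)) ∧ Pairwise (Disjoint on S') ∧
      Finset.univ.biUnion S' = S ∧
      single T = (treeAlg B a).act μ (fun j => single (c j)) := by
  by_cases hr : r = some a
  · subst hr
    cases h with
    | node _ hm i c r' S' hr hc hg hS =>
      exact ⟨_, B.basis a _ i, r', c, S', hr, hg, hS, rfl,
        (treeAlg_act_basis B a hm i (fun j => (hg j).isGen (hr j)) hc).symm⟩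
  · refine ⟨1, (P a).one, fun _ => r, fun _ => T, fun _ => S, fun _ => hr, fun _ => h, ?_, ?_, ?_⟩
    · exact fun i j hij => absurd (Subsingleton.elim i j) hij
    · simp
    · rw [(treeAlg B a).act_one]

theorem Alg.act_comp_concat {Q : SymmOperad K} {V : Type*} [AddCommGroup V] [Module K V]
    (A : Alg Q V) {m : ℕ} (k : Fin m → ℕ) (μ : Q.obj m) (ν : (i : Fin m) → Q.obj (k i))
    (v : (i : Fin m) → Fin (k i) → V) :
    A.act (Q.comp k μ ν) (concat v) = A.act μ fun i => A.act (ν i) (v i) := by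
  rw [A.act_comp]
  simp only [concat_apply]

theorem pairwise_disjoint_concat {m : ℕ} {k : Fin m → ℕ} {S : Fin m → Finset ℕ}
    {S' : (i : Fin m) → Fin (k i) → Finset ℕ} (hS : Pairwise (Disjoint on S))
    (hS' : ∀ i, Pairwise (Disjoint on (S' i))) (h : ∀ i, Finset.univ.biUnion (S' i) = S i) :
    Pairwise (Disjoint on (concat S')) := by
  intro p q hpq
  obtain ⟨⟨i, j⟩, rfl⟩ := finSigmaFinEquiv.surjective p
  obtain ⟨⟨i', j'⟩, rfl⟩ := finSigmaFinEquiv.surjective q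
  simp only [onFun, concat_apply]
  by_cases hi : i = i'
  · subst hi
    exact hS' i fun hj => hpq (by rw [hj])
  · refine Finset.disjoint_of_subset_left ?_ (Finset.disjoint_of_subset_right ?_ (hS hi))
    · rw [← h i]
      exact Finset.subset_biUnion_of_mem (S' i) (Finset.mem_univ _)
    · rw [← h i']
      exact Finset.subset_biUnion_of_mem (S' i') (Finset.mem_univ _)

theorem biUnion_concat {m : ℕ} {k : Fin m → ℕ} {S : Fin m → Finset ℕ}
    {S' : (i : Fin m) → Fin (k i) → Finset ℕ} (h : ∀ i, Finset.univ.biUnion (S' i) = S i) :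
    Finset.univ.biUnion (concat S') = Finset.univ.biUnion S := by
  ext x
  simp only [← h, Finset.mem_biUnion, Finset.mem_univ, true_and]
  constructor
  · rintro ⟨p, hp⟩
    exact ⟨_, _, hp⟩
  · rintro ⟨i, j, hx⟩
    refine ⟨finSigmaFinEquiv ⟨i, j⟩, ?_⟩
    rwa [concat_apply]

/-- Arguments with root label `a` would create an edge between equal labels. They are opened up
first, and associativity merges their root operations into `μ`, leaving only generators as
arguments. -/
theorem act_mem_goodSpan (a : Label) {m : ℕ} (μ : (P a).obj m) {S : Fin m → Finset ℕ}
    (hS : Pairwise (Disjoint on S)) (v : Fin m → OpTree B.ι →₀ K)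
    (hv : ∀ j, v j ∈ goodSpan K Set.univ (S j)) :
    (treeAlg B a).act μ v ∈ goodSpan K Set.univ (Finset.univ.biUnion S) := by
  refine MultilinearMap.apply_mem_of_mem_span ((treeAlg B a).act μ) _ _ ?_ v hv
  intro v hv
  choose r T _ hg hT using hv
  obtain rfl : v = fun j => single (T j) := funext hT
  choose k ν r' c S' hr' hg' hS' hS'' he using fun j => (hg j).exists_act_eq B a
  simp only [he]
  rw [← Alg.act_comp_concat, ← biUnion_concat hS'']
  exact act_mem_goodSpan_gen B a _ (r := concat r') (c := concat c) (fun q => hr' _ _)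
    (fun q => hg' _ _) (pairwise_disjoint_concat hS hS' hS'')

/-- An operad is generated by the images of a pair of morphisms. -/
def Generates {O : SymmOperad K} (π : ∀ a, Hom (P a) O) : Prop :=
  ∀ Q : (n : ℕ) → Submodule K (O.obj n),
    (∀ {m n : ℕ} (e : Fin m ≃ Fin n) (μ : O.obj m), μ ∈ Q m → O.map e μ ∈ Q n) →
    O.one ∈ Q 1 →
    (∀ {m : ℕ} (k : Fin m → ℕ) (μ : O.obj m) (ν : (i : Fin m) → O.obj (k i)),
      μ ∈ Q m → (∀ i, ν i ∈ Q (k i)) → O.comp k μ ν ∈ Q (∑ i, k i)) →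
    (∀ a n μ, (π a).app n μ ∈ Q n) → ∀ n t, t ∈ Q n

variable {O : SymmOperad K} {π : ∀ a, Hom (P a) O}
  (A : Alg O (OpTree B.ι →₀ K))

/-- The value of an operation on distinct leaves. -/
noncomputable def evalLeaves {n : ℕ} (w : Fin n → ℕ) : O.obj n →ₗ[K] (OpTree B.ι →₀ K) where
  toFun t := A.act t fun j => single (leaf (w j))
  map_add' _ _ := by rw [map_add, add_apply]
  map_smul' _ _ := by rw [map_smul, smul_apply, RingHom.id_apply]

variable {B A} (hA : ∀ a m (μ : (P a).obj m), A.act ((π a).app m μ) = (treeAlg B a).act μ)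

include hA

/-- The operations with this property are closed under composition and relabelling and contain the
images of both factors, hence are everything. -/
theorem Generates.act_mem_goodSpan (hgen : Generates π) {n : ℕ} (t : O.obj n)
    {S : Fin n → Finset ℕ} (hS : Pairwise (Disjoint on S)) (v : Fin n → OpTree B.ι →₀ K)
    (hv : ∀ j, v j ∈ goodSpan K Set.univ (S j)) :
    A.act t v ∈ goodSpan K Set.univ (Finset.univ.biUnion S) := by
  let Q (n : ℕ) : Submodule K (O.obj n) :=
    { carrier := {t | ∀ S : Fin n → Finset ℕ, Pairwise (Disjoint on S) →
        ∀ v : Fin n → OpTree B.ι →₀ K, (∀ j, v j ∈ goodSpan K Set.univ (S j)) →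
        A.act t v ∈ goodSpan K Set.univ (Finset.univ.biUnion S)}
      add_mem' := fun ha hb S hS v hv => by
        rw [map_add, add_apply]
        exact Submodule.add_mem _ (ha S hS v hv) (hb S hS v hv)
      zero_mem' := fun S hS v hv => by simp
      smul_mem' := fun c x hx S hS v hv => by
        rw [map_smul, smul_apply]
        exact Submodule.smul_mem _ _ (hx S hS v hv) }
  refine hgen Q ?_ ?_ ?_ ?_ n t S hS v hv
  · intro m n e μ hμ S hS v hv
    rw [A.act_map]
    have := hμ (S ∘ e) (hS.comp_of_injective e.injective) _ fun j => hv (e j)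
    have hu : Finset.univ.biUnion (S ∘ e) = Finset.univ.biUnion S := by
      ext x
      simp only [Finset.mem_biUnion, Finset.mem_univ, true_and, comp_apply]
      exact e.exists_congr_left.trans (by simp)
    rwa [hu] at this
  · intro S hS v hv
    rw [A.act_one]
    simpa using hv 0
  · intro m k μ ν hμ hν S hS v hv
    rw [A.act_comp]
    let S' (i : Fin m) (j : Fin (k i)) : Finset ℕ := S (finSigmaFinEquiv ⟨i, j⟩)
    have hS' : concat S' = S := by
      ext1 q
      simp [S', concat]
    rw [← hS', biUnion_concat fun i => rfl]
    refine hμ _ ?_ _ fun i => hν i _ ?_ _ fun j => hv _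
    · intro i i' hi
      simp only [onFun, Finset.disjoint_biUnion_left, Finset.disjoint_biUnion_right]
      exact fun j _ j' _ => hS fun h =>
        hi (congrArg Sigma.fst (finSigmaFinEquiv.injective h))
    · intro j j' hj
      exact hS fun h => hj (by simpa using finSigmaFinEquiv.injective h)
  · intro a n μ S hS v hv
    rw [hA]
    exact SymmOperad.act_mem_goodSpan B a μ hS v hv

theorem Generates.evalLeaves_mem (hgen : Generates π) {n : ℕ} {w : Fin n → ℕ} (hw : Injective w)
    (t : O.obj n) : evalLeaves B A w t ∈ goodSpan K Set.univ (Finset.univ.image w) := by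
  have := hgen.act_mem_goodSpan hA t (S := fun j => {w j})
    (fun i j hij => by simpa [onFun] using fun h => hij (hw h))
    (fun j => single (leaf (w j))) fun j => single_mem_goodSpan (Good.leaf _) trivial
  rwa [Finset.biUnion_singleton] at this

theorem evalLeaves_mem_node (a : Label) {m n : ℕ} (hm : 2 ≤ m) (k : Fin m → ℕ) (μ : (P a).obj m)
    (r : Fin m → Option Label) (t : (i : Fin m) → O.obj (k i)) (hr : ∀ i, r i ≠ some a)
    (ih : ∀ i (w : Fin (k i) → ℕ), Injective w →
      evalLeaves B A w (t i) ∈ goodSpan K {r i} (Finset.univ.image w))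
    (e : Fin (∑ i, k i) ≃ Fin n) {w : Fin n → ℕ} (hw : Injective w) :
    evalLeaves B A w (O.map e (O.comp k ((π a).app m μ) t)) ∈
      goodSpan K {some a} (Finset.univ.image w) := by
  change A.act _ _ ∈ _
  rw [A.act_map, A.act_comp, hA]
  let w' (i : Fin m) (j : Fin (k i)) : ℕ := w (e (finSigmaFinEquiv ⟨i, j⟩))
  have hw' : ∀ i, Injective (w' i) := fun i j j' h => by
    simpa using finSigmaFinEquiv.injective (e.injective (hw h))
  have hS : Pairwise (Disjoint on fun i => Finset.univ.image (w' i)) := by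
    intro i i' hi
    simp only [onFun, Finset.disjoint_left, Finset.mem_image, Finset.mem_univ, true_and]
    rintro _ ⟨j, rfl⟩ ⟨j', h⟩
    exact hi (congrArg Sigma.fst (finSigmaFinEquiv.injective (e.injective (hw h)))).symm
  have hu : (Finset.univ.biUnion fun i => Finset.univ.image (w' i)) = Finset.univ.image w := by
    ext x
    simp only [Finset.mem_biUnion, Finset.mem_image, Finset.mem_univ, true_and, w']
    constructor
    · rintro ⟨i, j, rfl⟩
      exact ⟨_, rfl⟩
    · rintro ⟨q, rfl⟩
      obtain ⟨q, rfl⟩ := e.surjective q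
      obtain ⟨⟨i, j⟩, rfl⟩ := finSigmaFinEquiv.surjective q
      exact ⟨i, j, rfl⟩
  rw [← hu]
  refine MultilinearMap.apply_mem_of_mem_span ((treeAlg B a).act μ) _ _ ?_ _
    fun i => ih i (w' i) (hw' i)
  intro v hv
  choose r' T hr' hg hT using hv
  obtain rfl : v = fun j => single (T j) := funext hT
  exact act_mem_goodSpan_of_two_le B a hm μ (fun j => by rw [hr' j]; exact hr j) hg hS

theorem IsTree.evalLeaves_mem {r : Option Label} {n : ℕ} {t : O.obj n}
    (h : IsTree (π .bullet) (π .circ) r n t) {w : Fin n → ℕ} (hw : Injective w) :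
    evalLeaves B A w t ∈ goodSpan K {r} (Finset.univ.image w) := by
  induction h with
  | id =>
    change A.act _ _ ∈ _
    rw [A.act_one]
    simpa using single_mem_goodSpan (Good.leaf (w 0)) (Set.mem_singleton _)
  | bullet hm k μ r t hr ht e ih =>
    exact evalLeaves_mem_node hA .bullet hm k μ r t hr (fun i w hw => ih i hw) e hw
  | circ hm k μ r t hr ht e ih =>
    exact evalLeaves_mem_node hA .circ hm k μ r t hr (fun i w hw => ih i hw) e hw

omit hA in
theorem IsTree.node (a : Label) {m n : ℕ} (hm : 2 ≤ m) (k : Fin m → ℕ) (μ : (P a).obj m)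
    (r : Fin m → Option Label) (t : (i : Fin m) → O.obj (k i)) (hr : ∀ i, r i ≠ some a)
    (ht : ∀ i, IsTree (π .bullet) (π .circ) (r i) (k i) (t i)) (e : Fin (∑ i, k i) ≃ Fin n) :
    IsTree (π .bullet) (π .circ) (some a) n (O.map e (O.comp k ((π a).app m μ) t)) := by
  cases a with
  | bullet => exact .bullet hm k μ r t hr ht e
  | circ => exact .circ hm k μ r t hr ht e

omit hA in
theorem exists_equiv_of_image_eq {m n : ℕ} {w : Fin m → ℕ} {w' : Fin n → ℕ} (hw : Injective w)
    (hw' : Injective w') (h : Finset.univ.image w = Finset.univ.image w') :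
    ∃ e : Fin m ≃ Fin n, ∀ i, w' (e i) = w i := by
  have h1 : ∀ i, ∃ j, w' j = w i := fun i => by
    have : w i ∈ Finset.univ.image w' := h ▸ Finset.mem_image_of_mem w (Finset.mem_univ i)
    simpa using this
  choose f hf using h1
  refine ⟨Equiv.ofBijective f ⟨fun i j hij => hw (by rw [← hf, ← hf, hij]), fun j => ?_⟩, hf⟩
  have : w' j ∈ Finset.univ.image w := h ▸ Finset.mem_image_of_mem w' (Finset.mem_univ j)
  obtain ⟨i, -, hi⟩ := Finset.mem_image.1 this
  exact ⟨i, hw' (by rw [hf, hi])⟩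

/-- Surjectivity onto the good trees: the tree is rebuilt inside `O` with the same shape and
decorations. -/
theorem OpTree.Good.exists_isTree {r : Option Label} {T : OpTree B.ι} {S : Finset ℕ}
    (h : Good r T S) {n : ℕ} {w : Fin n → ℕ} (hw : Injective w) (hS : Finset.univ.image w = S) :
    ∃ t, IsTree (π .bullet) (π .circ) r n t ∧ evalLeaves B A w t = single T := by
  induction h generalizing n with
  | leaf l =>
    obtain rfl : n = 1 := by
      have := congrArg Finset.card hS
      rwa [Finset.card_image_of_injective _ hw, Finset.card_univ, Fintype.card_fin,
        Finset.card_singleton] at this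
    refine ⟨O.one, .id, ?_⟩
    change A.act _ _ = _
    rw [A.act_one]
    have : w 0 ∈ ({l} : Finset ℕ) := hS ▸ Finset.mem_image_of_mem w (Finset.mem_univ 0)
    rw [Finset.mem_singleton.1 this]
  | @node a m hm i c r S' hr hc hg hS' ih =>
    let k (j : Fin m) : ℕ := (S' j).card
    -- Each subtree is evaluated at the increasing enumeration of its own leaf set; the bijection
    -- `e` below rearranges the concatenation of these into `w`.
    let w' (j : Fin m) : Fin (k j) → ℕ := (S' j).orderEmbOfFin rfl
    have hw' : ∀ j, Injective (w' j) := fun j => ((S' j).orderEmbOfFin rfl).injective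
    have hi : ∀ j, Finset.univ.image (w' j) = S' j := fun j => by
      rw [← Finset.coe_inj, Finset.coe_image, Finset.coe_univ, Set.image_univ]
      exact Finset.range_orderEmbOfFin _ _
    choose t ht htT using fun j => ih j (hw' j) (hi j)
    have hmem : ∀ j x, w' j x ∈ S' j := fun j x => by
      rw [← hi j]
      exact Finset.mem_image_of_mem _ (Finset.mem_univ x)
    have hinj : Injective (concat w') := by
      intro p q hpq
      obtain ⟨⟨x, y⟩, rfl⟩ := finSigmaFinEquiv.surjective p
      obtain ⟨⟨x', y'⟩, rfl⟩ := finSigmaFinEquiv.surjective q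
      rw [concat_apply, concat_apply] at hpq
      by_cases hx : x = x'
      · subst hx
        rw [hw' x hpq]
      · exact absurd hpq (Finset.disjoint_iff_ne.1 (hS' hx) _ (hmem _ _) _ (hmem _ _))
    have him : Finset.univ.image (concat w') = Finset.univ.image w := by
      rw [hS]
      ext x
      simp only [Finset.mem_biUnion, Finset.mem_image, Finset.mem_univ, true_and, ← hi]
      constructor
      · rintro ⟨q, rfl⟩
        exact ⟨_, _, rfl⟩
      · rintro ⟨j, y, rfl⟩
        exact ⟨finSigmaFinEquiv ⟨j, y⟩, concat_apply _ _ _⟩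
    obtain ⟨e, he⟩ := exists_equiv_of_image_eq hinj hw him
    refine ⟨_, IsTree.node a hm k (B.basis a m i) r t hr ht e, ?_⟩
    change A.act _ _ = _
    rw [A.act_map, A.act_comp, hA]
    simp only [he, concat_apply]
    rw [single, ← treeAlg_act_basis B a hm i (fun j => (hg j).isGen (hr j)) hc]
    congr 1
    ext1 j
    exact htT j

end SymmOperad

/-! ### Faithfulness of the evaluation, and the resulting basis. -/

namespace SymmOperad

open Function OpTree

variable {K : Type u} [Field K]

/-- The span of the products in which a given generator occurs. -/
noncomputable def multiples (O : SymmOperad K) (l : ℕ) : Submodule K (Squarefree O ℕ) :=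
  Submodule.span K {v | ∃ (m : ℕ) (w : Fin m → ℕ) (μ : O.obj m), l ∈ Set.range w ∧
    v = word O ℕ w μ}

theorem squarefree_act_mem {O : SymmOperad K} (Q : Submodule K (Squarefree O ℕ)) {n : ℕ}
    (I : Set (Fin n)) (l : ℕ) (t : O.obj n) (v : Fin n → Squarefree O ℕ)
    (hv : ∀ i ∈ I, v i ∈ multiples O l)
    (h : ∀ (k : Fin n → ℕ) (w : (i : Fin n) → Fin (k i) → ℕ) (ν : (i : Fin n) → O.obj (k i)),
      (∀ i ∈ I, l ∈ Set.range (w i)) → word O ℕ (concat w) (O.comp k t ν) ∈ Q) :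
    (squarefree O ℕ).act t v ∈ Q := by
  classical
  refine ((squarefree O ℕ).act t).apply_mem_of_mem_span
    (fun i => {v | ∃ (m : ℕ) (w : Fin m → ℕ) (μ : O.obj m), (i ∈ I → l ∈ Set.range w) ∧
      v = word O ℕ w μ}) Q ?_ v fun i => ?_
  · intro v hv
    choose k w ν hw hv using hv
    obtain rfl : v = fun i => word O ℕ (w i) (ν i) := funext hv
    change squarefreeAct O ℕ t _ ∈ Q
    rw [squarefreeAct_word]
    exact h k w ν hw
  · by_cases hi : i ∈ I
    · simpa [hi, multiples] using hv i hi
    · simpa [hi] using mem_span_word (v i)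

theorem squarefree_act_mem_multiples {O : SymmOperad K} {n : ℕ} {l : ℕ} (t : O.obj n)
    (v : Fin n → Squarefree O ℕ) (i : Fin n) (hv : v i ∈ multiples O l) :
    (squarefree O ℕ).act t v ∈ multiples O l := by
  refine squarefree_act_mem _ {i} l t v (by simpa using hv) fun k w ν h => ?_
  obtain ⟨j, hj⟩ := h i rfl
  refine Submodule.subset_span ⟨_, _, _, ⟨finSigmaFinEquiv ⟨i, j⟩, ?_⟩, rfl⟩
  rw [concat_apply, hj]

theorem squarefree_act_eq_zero {O : SymmOperad K} {n : ℕ} {l : ℕ} (t : O.obj n)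
    (v : Fin n → Squarefree O ℕ) {i j : Fin n} (hij : i ≠ j) (hi : v i ∈ multiples O l)
    (hj : v j ∈ multiples O l) : (squarefree O ℕ).act t v = 0 := by
  rw [← Submodule.mem_bot K]
  refine squarefree_act_mem _ {i, j} l t v (by simp [hi, hj]) fun k w ν h => ?_
  obtain ⟨x, hx⟩ := h i (by simp)
  obtain ⟨y, hy⟩ := h j (by simp)
  rw [word_of_not_injective]
  · exact Submodule.zero_mem _
  · intro hw
    refine hij (congrArg Sigma.fst (finSigmaFinEquiv.injective
      (@hw (finSigmaFinEquiv ⟨i, x⟩) (finSigmaFinEquiv ⟨j, y⟩) ?_)))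
    rw [concat_apply, concat_apply, hx, hy]

variable {P : Label → SymmOperad K} {B : Bases P} {O : SymmOperad K} (π : ∀ a, Hom (P a) O)

variable (B) in
/-- The value of a tree in the squarefree free algebra generated by the leaf labels. -/
noncomputable def evalTree : OpTree B.ι → Squarefree O ℕ
  | leaf l => word O ℕ (fun _ : Fin 1 => l) O.one
  | node a m i c => (squarefree O ℕ).act ((π a).app m (B.basis a m i)) fun j => evalTree (c j)

/-- The label of any leaf will do, and following first children reaches one because no vertex is
nullary. This makes products with a repeated tree vanish in the target, as they do in `treeAlg`. -/
theorem exists_evalTree_mem (T : OpTree B.ι) : ∃ l, evalTree B π T ∈ multiples O l := by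
  induction T with
  | leaf l => exact ⟨l, Submodule.subset_span ⟨_, _, _, ⟨0, rfl⟩, rfl⟩⟩
  | node a m i c ih =>
    match m with
    | 0 => exact isEmptyElim i
    | m + 1 =>
      obtain ⟨l, hl⟩ := ih 0
      exact ⟨l, squarefree_act_mem_multiples _ _ 0 hl⟩

variable (B) in
/-- The linear extension of `evalTree`. -/
noncomputable def evalLinear : (OpTree B.ι →₀ K) →ₗ[K] Squarefree O ℕ :=
  Finsupp.linearCombination K (evalTree B π)

theorem evalLinear_single (T : OpTree B.ι) : evalLinear B π (single T) = evalTree B π T := by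
  simp [evalLinear, single]

theorem evalLinear_act_gen (a : Label) {m : ℕ} (μ : (P a).obj m) {c : Fin m → OpTree B.ι}
    (hg : ∀ j, IsGen a (c j)) :
    evalLinear B π ((treeAlg B a).act μ fun j => single (c j)) =
      (squarefree O ℕ).act ((π a).app m μ) fun j => evalTree B π (c j) := by
  by_cases hc : Injective c
  · have hs := exists_strictMono_comp_sort hc
    rw [← (treeAlg B a).act_sort (Tuple.sort c), ← (squarefree O ℕ).act_sort (Tuple.sort c),
      ← (π a).app_map]
    generalize (P a).map (Tuple.sort c).symm μ = μ'
    match m with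
    | 0 =>
      rw [(P a).obj_zero.elim μ' 0]
      simp
    | 1 =>
      obtain ⟨k, rfl⟩ := B.exists_smul_one a μ'
      rw [map_smul, map_smul, map_smul, smul_apply, smul_apply, (treeAlg B a).act_one,
        (π a).app_one, (squarefree O ℕ).act_one, map_smul, comp_apply, evalLinear_single]
      rfl
    | m + 2 =>
      have hμ : μ' ∈ Submodule.span K (Set.range (B.basis a (m + 2))) := by
        rw [(B.basis a _).span_eq]
        trivial
      induction hμ using Submodule.span_induction with
      | mem x hx =>
        obtain ⟨i, rfl⟩ := hx
        have := treeAlg_act_basis B a (by omega) i (fun j => hg (Tuple.sort c j)) hs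
        refine (congrArg _ this).trans ?_
        exact evalLinear_single π _
      | zero => simp
      | add x y _ _ hx hy => simp only [map_add, add_apply, hx, hy]
      | smul k x _ hx => simp only [map_smul, smul_apply, hx]
  · rw [treeAlg_act_of_not_injective B a μ hg hc, map_zero]
    rw [Injective] at hc
    push Not at hc
    obtain ⟨i, j, h, hij⟩ := hc
    obtain ⟨l, hl⟩ := exists_evalTree_mem π (c i)
    exact (squarefree_act_eq_zero _ _ hij hl (by rwa [← h])).symm

theorem exists_act_gen_eq (a : Label) (T : OpTree B.ι) :
    ∃ (m : ℕ) (μ : (P a).obj m) (c : Fin m → OpTree B.ι), (∀ j, IsGen a (c j)) ∧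
      single T = (treeAlg B a).act μ (fun j => single (c j)) := by
  by_cases h : IsGen a T
  · exact ⟨1, (P a).one, fun _ => T, fun _ => h, by rw [(treeAlg B a).act_one]⟩
  · cases T with
    | leaf l => exact absurd trivial h
    | node a' m i c =>
      rw [IsGen, not_not] at h
      obtain ⟨rfl, hm, hc, hg⟩ := h
      exact ⟨m, B.basis a' m i, c, hg, (treeAlg_act_basis B a' hm i hg hc).symm⟩

/-- Every tree is an operation applied to generators for `a`, so associativity on both sides reduces
the claim to `evalLinear_act_gen`. -/
theorem evalLinear_act (a : Label) {m : ℕ} (μ : (P a).obj m) (v : Fin m → OpTree B.ι →₀ K) :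
    evalLinear B π ((treeAlg B a).act μ v) =
      (squarefree O ℕ).act ((π a).app m μ) fun j => evalLinear B π (v j) := by
  refine MultilinearMap.eq_of_mem_span
    ((evalLinear B π).compMultilinearMap ((treeAlg B a).act μ))
    (((squarefree O ℕ).act ((π a).app m μ)).compLinearMap fun _ => evalLinear B π)
    (fun _ => Set.range fun T : OpTree B.ι => single T) ?_ v fun i => ?_
  · intro v hv
    choose T hT using hv
    choose k ν c hg hc using fun j => exists_act_gen_eq a (T j)
    obtain rfl : v = fun j => (treeAlg B a).act (ν j) fun i => single (c j i) := by
      ext1 j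
      rw [← hT, ← hc]
    change evalLinear B π ((treeAlg B a).act μ _) =
      (squarefree O ℕ).act ((π a).app m μ) fun j => evalLinear B π _
    simp only [evalLinear_act_gen π a _ (hg _)]
    rw [← Alg.act_comp_concat, ← Alg.act_comp_concat, ← (π a).app_comp]
    exact evalLinear_act_gen π a _ (c := concat c) fun q => hg _ _
  · have := (Finsupp.basisSingleOne (R := K) (ι := OpTree B.ι)).span_eq
    rw [Finsupp.coe_basisSingleOne] at this
    rw [this]
    trivial

variable {π}

theorem Generates.evalLinear_act (hgen : Generates π) {A : Alg O (OpTree B.ι →₀ K)}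
    (hA : ∀ a m (μ : (P a).obj m), A.act ((π a).app m μ) = (treeAlg B a).act μ) {n : ℕ}
    (t : O.obj n) (v : Fin n → OpTree B.ι →₀ K) :
    evalLinear B π (A.act t v) = (squarefree O ℕ).act t fun j => evalLinear B π (v j) := by
  let Q (n : ℕ) : Submodule K (O.obj n) :=
    { carrier := {t | ∀ v : Fin n → OpTree B.ι →₀ K,
        evalLinear B π (A.act t v) = (squarefree O ℕ).act t fun j => evalLinear B π (v j)}
      add_mem' := fun ha hb v => by simp only [map_add, add_apply, ha v, hb v]
      zero_mem' := fun v => by simp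
      smul_mem' := fun c x hx v => by simp only [map_smul, smul_apply, hx v] }
  refine hgen Q ?_ ?_ ?_ ?_ n t v
  · intro m n e μ hμ v
    rw [A.act_map, hμ, (squarefree O ℕ).act_map]
  · intro v
    rw [A.act_one, (squarefree O ℕ).act_one]
  · intro m k μ ν hμ hν v
    rw [A.act_comp, hμ, (squarefree O ℕ).act_comp]
    simp only [hν _ _]
  · intro a n μ v
    rw [hA, SymmOperad.evalLinear_act]

/-- If `t` vanishes at the leaves, multiplying out shows that `t` placed at the increasing word `0,
…, n - 1` is zero. That is a coordinate embedding of `O(n)` into a direct sum, so `t = 0`. -/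
theorem Generates.evalLeaves_injective (hgen : Generates π) {A : Alg O (OpTree B.ι →₀ K)}
    (hA : ∀ a m (μ : (P a).obj m), A.act ((π a).app m μ) = (treeAlg B a).act μ) (n : ℕ) :
    Injective (evalLeaves B A (n := n) Fin.val) := by
  rw [injective_iff_map_eq_zero]
  intro t ht
  have h := hgen.evalLinear_act hA t fun j => single (leaf j.val)
  have hmono : StrictMono (Fin.val : Fin n → ℕ) := fun _ _ h => h
  rw [show A.act t _ = 0 from ht, map_zero] at h
  simp only [evalLinear_single, evalTree] at h
  rw [squarefree_act_gen, word_of_strictMono hmono] at h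
  classical
  exact (DFinsupp.single_eq_zero (β := fun j : MonoWord ℕ => O.obj j.1)
    (i := ⟨n, Fin.val, hmono⟩)).1 (by
      refine Eq.trans ?_ h.symm
      rw [atMonoWord, DFinsupp.lsingle_apply])

/-- The span of the trees with root labelled `a`. -/
noncomputable def part (π : ∀ a, Hom (P a) O) (a : Label) (n : ℕ) : Submodule K (O.obj n) :=
  Submodule.span K {t | IsTree (π .bullet) (π .circ) (some a) n t}

theorem map_part {A : Alg O (OpTree B.ι →₀ K)}
    (hA : ∀ a m (μ : (P a).obj m), A.act ((π a).app m μ) = (treeAlg B a).act μ) (a : Label)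
    (n : ℕ) : (part π a n).map (evalLeaves B A Fin.val) =
      goodSpan K {some a} (Finset.univ.image (Fin.val : Fin n → ℕ)) := by
  apply le_antisymm
  · rw [part, Submodule.map_span_le]
    exact fun t ht => IsTree.evalLeaves_mem hA ht Fin.val_injective
  · rw [goodSpan, Submodule.span_le]
    rintro _ ⟨r, T, rfl, hg, rfl⟩
    obtain ⟨t, ht, h⟩ := hg.exists_isTree hA Fin.val_injective rfl
    exact ⟨t, Submodule.subset_span ht, h⟩

theorem goodSpan_eq {ι : Label → ℕ → Type u} (R : Set (Option Label)) (S : Finset ℕ) :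
    goodSpan K (ι := ι) R S = Finsupp.supported K K {T : OpTree ι | ∃ r ∈ R, Good r T S} := by
  rw [Finsupp.supported_eq_span_single, goodSpan]
  congr 1
  ext v
  constructor
  · rintro ⟨r, T, hr, hg, rfl⟩
    exact ⟨T, ⟨r, hr, hg⟩, rfl⟩
  · rintro ⟨T, ⟨r, hr, hg⟩, rfl⟩
    exact ⟨r, T, hr, hg, rfl⟩

theorem isCompl_part {A : Alg O (OpTree B.ι →₀ K)} (hgen : Generates π)
    (hA : ∀ a m (μ : (P a).obj m), A.act ((π a).app m μ) = (treeAlg B a).act μ) {n : ℕ}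
    (hn : 2 ≤ n) : IsCompl (part π .bullet n) (part π .circ n) := by
  have hinj := hgen.evalLeaves_injective hA n
  set f := evalLeaves B A (n := n) Fin.val
  set S := Finset.univ.image (Fin.val : Fin n → ℕ) with hS
  constructor
  · suffices h : Disjoint ((part π .bullet n).map f) ((part π .circ n).map f) by
      rw [Submodule.disjoint_def] at h ⊢
      intro x hx hx'
      exact (map_eq_zero_iff f hinj).1
        (h _ (Submodule.mem_map_of_mem hx) (Submodule.mem_map_of_mem hx'))
    rw [map_part hA, map_part hA, goodSpan_eq, goodSpan_eq,
      Finsupp.disjoint_supported_supported_iff, Set.disjoint_left]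
    rintro T ⟨r, rfl, h⟩ ⟨r', rfl, h'⟩
    simpa using (h.unique h').1
  · rw [codisjoint_iff, eq_top_iff]
    intro t _
    have h := hgen.evalLeaves_mem hA Fin.val_injective t
    have h' : goodSpan K Set.univ S ≤
        (part π .bullet n ⊔ part π .circ n).map f := by
      rw [Submodule.map_sup, map_part hA, map_part hA, goodSpan, Submodule.span_le]
      rintro _ ⟨r, T, -, hg, rfl⟩
      match r with
      -- The trivial tree has one leaf, while here there are `n ≥ 2`.
      | none =>
        generalize hS' : S = S' at hg
        cases hg
        have := congrArg Finset.card hS'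
        rw [hS, Finset.card_image_of_injective _ Fin.val_injective] at this
        simp at this
        omega
      | some .bullet =>
        exact Submodule.mem_sup_left (single_mem_goodSpan hg rfl)
      | some .circ =>
        exact Submodule.mem_sup_right (single_mem_goodSpan hg rfl)
    obtain ⟨t', ht', he⟩ := h' h
    rwa [← hinj he]

theorem rank_part {A : Alg O (OpTree B.ι →₀ K)} (hgen : Generates π)
    (hA : ∀ a m (μ : (P a).obj m), A.act ((π a).app m μ) = (treeAlg B a).act μ) (a : Label)
    (n : ℕ) : Module.rank K (part π a n) =
      Cardinal.mk {T : OpTree B.ι // Good (some a) T (Finset.range n)} := by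
  have hinj := hgen.evalLeaves_injective hA n
  rw [(Submodule.equivMapOfInjective _ hinj (part π a n)).rank_eq, map_part hA, goodSpan_eq,
    (Finsupp.supportedEquivFinsupp _).rank_eq, rank_finsupp_self']
  simp only [Set.mem_singleton_iff, exists_eq_left, Set.coe_ofPred]
  have : Finset.univ.image (Fin.val : Fin n → ℕ) = Finset.range n := by
    ext x
    simp only [Finset.mem_image, Finset.mem_univ, true_and, Finset.mem_range]
    exact ⟨fun ⟨i, hi⟩ => hi ▸ i.2, fun h => ⟨⟨x, h⟩, rfl⟩⟩
  rw [this]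

end SymmOperad

/-! ### Counting good trees. -/

theorem Cardinal.mk_sigma_finset {ι : Type} (F : Finset ι) (f : ι → Type u) :
    Cardinal.mk (Σ i : F, f i) = ∑ i ∈ F, Cardinal.mk (f i) := by
  classical
  have h : ∀ F : Finset ι, Cardinal.mk {t : Sigma f | t.1 ∈ F} = ∑ i ∈ F, Cardinal.mk (f i) := by
    intro F
    induction F using Finset.induction_on with
    | empty => simp
    | insert a F ha ih =>
      rw [Finset.sum_insert ha, ← ih, ← Cardinal.mk_congr (Equiv.sigmaSubtype (β := f) a)]
      refine (congrArg (fun s : Set (Sigma f) => Cardinal.mk s) ?_).trans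
        (Cardinal.mk_union_of_disjoint (S := {t : Sigma f | t.1 = a}) (T := {t | t.1 ∈ F}) ?_)
      · ext t
        simp
      · rw [Set.disjoint_left]
        rintro t rfl
        exact ha
  rw [← h F]
  exact Cardinal.mk_congr (Equiv.subtypeSigmaEquiv f (· ∈ F)).symm

namespace SymmOperad

open Function OpTree Cardinal

/-- The label different from a given one. -/
def Label.other : Label → Label
  | bullet => circ
  | circ => bullet

theorem some_other_ne (a : Label) : some a.other ≠ some a := by
  cases a <;> simp [Label.other]

theorem Label.eq_other {a b : Label} (h : b ≠ a) : b = a.other := by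
  cases a <;> cases b <;> simp_all [Label.other]

namespace OpTree

variable {ι : Label → ℕ → Type u}

/-- The set of leaf labels. -/
def leaves : OpTree ι → Finset ℕ
  | leaf l => {l}
  | node _ _ _ c => Finset.univ.biUnion fun j => leaves (c j)

theorem Good.leaves_eq {r : Option Label} {T : OpTree ι} {S : Finset ℕ} (h : Good r T S) :
    leaves T = S := by
  induction h with
  | leaf l => rfl
  | node a hm i c r S hr hc hg hS ih =>
    rw [leaves]
    simp only [ih]

/-- The trees allowed as subtrees at a vertex with label `a`. -/
def IsChild (a : Label) (T : OpTree ι) (S : Finset ℕ) : Prop :=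
  ∃ r, r ≠ some a ∧ Good r T S

theorem IsChild.leaves_eq {a : Label} {T : OpTree ι} {S : Finset ℕ} (h : IsChild a T S) :
    leaves T = S := by
  obtain ⟨r, -, h⟩ := h
  exact h.leaves_eq

theorem mk_isChild_of_card_eq_one (a : Label) {S : Finset ℕ} (hS : S.card = 1) :
    Cardinal.mk {T : OpTree ι // IsChild a T S} = 1 := by
  obtain ⟨l, rfl⟩ := Finset.card_eq_one.1 hS
  rw [Cardinal.eq_one_iff_unique]
  have key : ∀ T : OpTree ι, IsChild a T {l} → T = leaf l := by
    rintro T ⟨r, -, h⟩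
    generalize hS' : ({l} : Finset ℕ) = S' at h
    cases h with
    | leaf l' =>
      rw [Finset.singleton_inj.1 hS']
    | @node a' m hm i c r S hr hc hg hd =>
      exfalso
      obtain ⟨x, hx⟩ := (hg ⟨0, by omega⟩).nonempty
      obtain ⟨y, hy⟩ := (hg ⟨1, by omega⟩).nonempty
      have hx' : x ∈ ({l} : Finset ℕ) := hS' ▸ Finset.mem_biUnion.2 ⟨_, Finset.mem_univ _, hx⟩
      have hy' : y ∈ ({l} : Finset ℕ) := hS' ▸ Finset.mem_biUnion.2 ⟨_, Finset.mem_univ _, hy⟩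
      rw [Finset.mem_singleton] at hx' hy'
      subst hx' hy'
      have hd : Disjoint (S ⟨0, by omega⟩) (S ⟨1, by omega⟩) := hd (by simp)
      exact Finset.disjoint_left.1 hd hx hy
  exact ⟨⟨fun T T' => Subtype.ext ((key _ T.2).trans (key _ T'.2).symm)⟩,
    ⟨⟨leaf l, none, by simp, .leaf l⟩⟩⟩

theorem mk_isChild_of_two_le_card (a : Label) {S : Finset ℕ} (hS : 2 ≤ S.card) :
    Cardinal.mk {T : OpTree ι // IsChild a T S} =
      Cardinal.mk {T : OpTree ι // Good (some a.other) T S} := by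
  refine Cardinal.mk_congr (Equiv.subtypeEquivRight fun T => ⟨?_, fun h => ⟨_, some_other_ne a, h⟩⟩)
  rintro ⟨r, hr, h⟩
  match r with
  | none =>
    cases h
    simp at hS
  | some b =>
    rwa [Label.eq_other (a := a) (b := b) (by simpa using hr)] at h

/-- The sets of `m` subtrees at a vertex with label `a` whose leaf labels make up `S`. -/
def IsForest (a : Label) (m : ℕ) (S : Finset ℕ) (s : Finset (OpTree ι)) : Prop :=
  s.card = m ∧ (∀ T ∈ s, IsChild a T (leaves T)) ∧ (s : Set (OpTree ι)).PairwiseDisjoint leaves ∧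
    s.biUnion leaves = S

theorem IsForest.card_le {a : Label} {m : ℕ} {S : Finset ℕ} {s : Finset (OpTree ι)}
    (h : IsForest a m S s) : m ≤ S.card := by
  obtain ⟨rfl, h1, h2, rfl⟩ := h
  rw [Finset.card_biUnion h2, Finset.card_eq_sum_ones]
  refine Finset.sum_le_sum fun T hT => ?_
  obtain ⟨r, -, h⟩ := h1 T hT
  exact h.nonempty.card_pos

theorem mk_isForest_zero (a : Label) (S : Finset ℕ) :
    Cardinal.mk {s : Finset (OpTree ι) // IsForest a 0 S s} = if S.card = 0 then 1 else 0 := by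
  split_ifs with h
  · rw [Finset.card_eq_zero] at h
    subst h
    rw [Cardinal.eq_one_iff_unique]
    refine ⟨⟨fun s t => Subtype.ext ?_⟩, ⟨⟨∅, rfl, by simp, by simp, by simp⟩⟩⟩
    rw [Finset.card_eq_zero.1 s.2.1, Finset.card_eq_zero.1 t.2.1]
  · rw [Cardinal.mk_eq_zero_iff]
    refine ⟨?_⟩
    rintro ⟨s, hs, -, -, hS⟩
    apply h
    rw [Finset.card_eq_zero.1 hs] at hS
    simp [← hS]

theorem mk_isForest_succ_empty (a : Label) (m : ℕ) :
    Cardinal.mk {s : Finset (OpTree ι) // IsForest a (m + 1) ∅ s} = 0 := by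
  rw [Cardinal.mk_eq_zero_iff]
  refine ⟨fun ⟨s, hs⟩ => ?_⟩
  have := hs.card_le
  simp at this

/-- Split off the tree containing the marked leaf `x`; the set `U` consists of its other leaves. -/
theorem mk_isForest_succ (a : Label) (m : ℕ) {S : Finset ℕ} {x : ℕ} (hx : x ∈ S) :
    Cardinal.mk {s : Finset (OpTree ι) // IsForest a (m + 1) S s} =
      ∑ U ∈ (S.erase x).powerset, Cardinal.mk {T : OpTree ι // IsChild a T (insert x U)} *
        Cardinal.mk {s : Finset (OpTree ι) // IsForest a m (S.erase x \ U) s} := by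
  have hout : ∀ {U s T}, IsForest a m (S.erase x \ U) s → T ∈ s → x ∉ leaves (ι := ι) T := by
    rintro U s T ⟨-, -, -, h⟩ hT hx
    have : x ∈ S.erase x \ U := h ▸ Finset.mem_biUnion.2 ⟨T, hT, hx⟩
    simp at this
  have hin : ∀ {U T}, IsChild a T (insert x U) → x ∈ leaves (ι := ι) T := by
    intro U T h
    rw [h.leaves_eq]
    exact Finset.mem_insert_self x U
  have hnot : ∀ {U T s}, IsChild a T (insert x U) → IsForest a m (S.erase x \ U) s →
      T ∉ s := fun hT hs h => hout hs h (hin hT)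
  have hxU : ∀ {U}, U ∈ (S.erase x).powerset → x ∉ U := fun hU h => by
    simpa using Finset.mem_powerset.1 hU h
  simp only [Cardinal.mul_def]
  rw [← Cardinal.mk_sigma_finset]
  refine (Cardinal.mk_congr (Equiv.ofBijective (fun y : Σ U : (S.erase x).powerset,
    {T : OpTree ι // IsChild a T (insert x U.1)} ×
      {s : Finset (OpTree ι) // IsForest a m (S.erase x \ U.1) s} =>
    (⟨insert y.2.1.1 y.2.2.1, ?_⟩ : {s : Finset (OpTree ι) // IsForest a (m + 1) S s}))
    ⟨?_, ?_⟩)).symm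
  · obtain ⟨⟨U, hU⟩, ⟨T, hT⟩, ⟨s, hs⟩⟩ := y
    simp only
    refine ⟨?_, ?_, ?_, ?_⟩
    · rw [Finset.card_insert_of_notMem (hnot hT hs), hs.1]
    · intro T' hT'
      rcases Finset.mem_insert.1 hT' with rfl | hT'
      · rwa [hT.leaves_eq]
      · exact hs.2.1 T' hT'
    · rw [Finset.coe_insert]
      refine hs.2.2.1.insert fun T' hT' _ => ?_
      rw [hT.leaves_eq, Finset.disjoint_insert_left]
      refine ⟨hout hs hT', ?_⟩
      have : leaves T' ⊆ S.erase x \ U := by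
        rw [← hs.2.2.2]
        exact Finset.subset_biUnion_of_mem leaves hT'
      exact Finset.disjoint_of_subset_right this Finset.disjoint_sdiff
    · rw [Finset.biUnion_insert, hs.2.2.2, hT.leaves_eq, Finset.insert_union,
        Finset.union_sdiff_of_subset (Finset.mem_powerset.1 hU), Finset.insert_erase hx]
  · rintro ⟨⟨U, hU⟩, ⟨T, hT⟩, ⟨s, hs⟩⟩ ⟨⟨U', hU'⟩, ⟨T', hT'⟩, ⟨s', hs'⟩⟩ h
    replace h : insert T s = insert T' s' := congrArg Subtype.val h
    have hTT : T = T' := by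
      have : T ∈ insert T' s' := h ▸ Finset.mem_insert_self T s
      rcases Finset.mem_insert.1 this with h' | h'
      · exact h'
      · exact absurd (hin hT) (hout hs' h')
    subst hTT
    obtain rfl : U = U' := by
      have := hT.leaves_eq.symm.trans hT'.leaves_eq
      rw [← Finset.erase_insert (hxU hU), this, Finset.erase_insert (hxU hU')]
    obtain rfl : s = s' := by
      rw [← Finset.erase_insert (hnot hT hs), h, Finset.erase_insert (hnot hT' hs')]
    rfl
  · rintro ⟨s, hs, hc, hd, hS⟩
    obtain ⟨T, hT, hxT⟩ := Finset.mem_biUnion.1 (hS ▸ hx)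
    have hsub : leaves T ⊆ S := by
      rw [← hS]
      exact Finset.subset_biUnion_of_mem leaves hT
    have hins : insert x ((leaves T).erase x) = leaves T := Finset.insert_erase hxT
    refine ⟨⟨⟨(leaves T).erase x, Finset.mem_powerset.2 (Finset.erase_subset_erase x hsub)⟩,
      ⟨T, ?_⟩, ⟨s.erase T, ?_, ?_, ?_, ?_⟩⟩, Subtype.ext (Finset.insert_erase hT)⟩
    · rw [hins]
      exact hc T hT
    · rw [Finset.card_erase_of_mem hT, hs]
      rfl
    · exact fun T' hT' => hc T' (Finset.mem_of_mem_erase hT')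
    · exact hd.subset (by simp)
    · ext y
      simp only [Finset.mem_biUnion, Finset.mem_erase, Finset.mem_sdiff, ← hS]
      constructor
      · rintro ⟨T', ⟨hne, hT'⟩, hy⟩
        have hdis := Finset.disjoint_left.1 (hd hT' hT hne) hy
        refine ⟨⟨?_, T', hT', hy⟩, fun h => hdis h.2⟩
        rintro rfl
        exact hdis hxT
      · rintro ⟨⟨hyx, T', hT', hy⟩, h⟩
        refine ⟨T', ⟨?_, hT'⟩, hy⟩
        rintro rfl
        exact h ⟨hyx, hy⟩

/-- The children of a vertex are strictly increasing, so the tuple is determined by its underlying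
set. Each child has a leaf, which bounds the arity by the number of leaves. -/
theorem mk_good (a : Label) (S : Finset ℕ) :
    Cardinal.mk {T : OpTree ι // Good (some a) T S} = ∑ m ∈ Finset.Icc 2 S.card,
      Cardinal.mk (ι a m) * Cardinal.mk {s : Finset (OpTree ι) // IsForest a m S s} := by
  simp only [Cardinal.mul_def]
  rw [← Cardinal.mk_sigma_finset]
  have himg : ∀ {m} {s : Finset (OpTree ι)} (h : s.card = m),
      Finset.univ.image (s.orderEmbOfFin h) = s := fun h => by
    rw [← Finset.coe_inj, Finset.coe_image, Finset.coe_univ, Set.image_univ]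
    exact Finset.range_orderEmbOfFin _ _
  refine (Cardinal.mk_congr (Equiv.ofBijective (fun y : Σ m : Finset.Icc 2 S.card,
    ι a m × {s : Finset (OpTree ι) // IsForest a m S s} =>
    (⟨node a y.1.1 y.2.1 (y.2.2.1.orderEmbOfFin y.2.2.2.1), ?_⟩ :
      {T : OpTree ι // Good (some a) T S})) ⟨?_, ?_⟩)).symm
  · obtain ⟨⟨m, hm⟩, i, ⟨s, hs⟩⟩ := y
    simp only
    obtain ⟨h1, hc, hd, hS⟩ := hs
    choose r hr hg using fun j => hc _ (s.orderEmbOfFin_mem h1 j)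
    have := Good.node a (Finset.mem_Icc.1 hm).1 i (s.orderEmbOfFin h1) r
      (fun j => leaves (s.orderEmbOfFin h1 j)) hr (s.orderEmbOfFin h1).strictMono hg
      (fun j j' hj => hd (s.orderEmbOfFin_mem h1 j) (s.orderEmbOfFin_mem h1 j')
        fun h => hj ((s.orderEmbOfFin h1).injective h))
    rwa [← Finset.image_biUnion, himg, hS] at this
  · rintro ⟨⟨m, hm⟩, i, ⟨s, hs⟩⟩ ⟨⟨m', hm'⟩, i', ⟨s', hs'⟩⟩ h
    have h := congrArg Subtype.val h
    simp only [node.injEq, true_and] at h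
    obtain ⟨rfl, hi, hc⟩ := h
    obtain rfl := eq_of_heq hi
    obtain rfl : s = s' := by
      rw [← himg hs.1, ← himg hs'.1, eq_of_heq hc]
    rfl
  · rintro ⟨T, hT⟩
    cases hT with
    | @node _ m hm i c r S hr hc hg hS =>
      let s := Finset.univ.image c
      have hs : s.card = m := by
        rw [Finset.card_image_of_injective _ hc.injective, Finset.card_univ, Fintype.card_fin]
      have hf : IsForest a m (Finset.univ.biUnion S) s := by
        refine ⟨hs, ?_, ?_, ?_⟩
        · intro T hT
          obtain ⟨j, -, rfl⟩ := Finset.mem_image.1 hT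
          rw [(hg j).leaves_eq]
          exact ⟨r j, hr j, hg j⟩
        · intro T hT T' hT' hne
          obtain ⟨j, -, rfl⟩ := Finset.mem_image.1 hT
          obtain ⟨j', -, rfl⟩ := Finset.mem_image.1 hT'
          simp only [onFun, (hg _).leaves_eq]
          exact hS fun h => hne (by rw [h])
        · rw [Finset.image_biUnion]
          simp only [(hg _).leaves_eq]
      refine ⟨⟨⟨m, Finset.mem_Icc.2 ⟨hm, hf.card_le⟩⟩, i, ⟨s, hf⟩⟩, Subtype.ext ?_⟩
      simp only
      congr 1
      exact (Finset.orderEmbOfFin_unique hs (fun j => Finset.mem_image_of_mem c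
        (Finset.mem_univ j)) hc).symm

/-- The number of partitions of an `n`-element set into `m` blocks, the number of structures on a
block with `k` elements being `h k`. -/
noncomputable def numForests (h : ℕ → Cardinal.{u}) : ℕ → ℕ → Cardinal.{u}
  | 0, n => if n = 0 then 1 else 0
  | _ + 1, 0 => 0
  | m + 1, n + 1 =>
    ∑ k ∈ Finset.range (n + 1), n.choose k • (h (k + 1) * numForests h m (n - k))

theorem mk_isForest (a : Label) (m : ℕ) (S : Finset ℕ) (h : ℕ → Cardinal.{u})
    (hh : ∀ U ⊆ S, U.Nonempty → Cardinal.mk {T : OpTree ι // IsChild a T U} = h U.card) :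
    Cardinal.mk {s : Finset (OpTree ι) // IsForest a m S s} = numForests h m S.card := by
  induction m generalizing S with
  | zero => rw [mk_isForest_zero, numForests]
  | succ m ih =>
    rcases S.eq_empty_or_nonempty with rfl | ⟨x, hx⟩
    · rw [mk_isForest_succ_empty, Finset.card_empty, numForests]
    · have hc : S.card = (S.erase x).card + 1 := (Finset.card_erase_add_one hx).symm
      rw [mk_isForest_succ a m hx, hc, numForests, ← Finset.sum_powerset_apply_card
        fun k => h (k + 1) * numForests h m ((S.erase x).card - k)]
      refine Finset.sum_congr rfl fun U hU => ?_
      have hU' := Finset.mem_powerset.1 hU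
      have hxU : x ∉ U := fun h => by simpa using hU' h
      rw [hh _ (Finset.insert_subset hx (hU'.trans (Finset.erase_subset x S)))
        (Finset.insert_nonempty x U), Finset.card_insert_of_notMem hxU, ih,
        Finset.card_sdiff_of_subset hU']
      exact fun V hV hVn => hh V (hV.trans (Finset.sdiff_subset.trans (Finset.erase_subset x S))) hVn

theorem numForests_congr {h h' : ℕ → Cardinal.{u}} (m : ℕ) {n : ℕ}
    (hh : ∀ k, k ≤ n → h k = h' k) : numForests h m n = numForests h' m n := by
  induction m generalizing n with
  | zero => rfl
  | succ m ih =>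
    cases n with
    | zero => rfl
    | succ n =>
      rw [numForests, numForests]
      refine Finset.sum_congr rfl fun k hk => ?_
      have := Finset.mem_range.1 hk
      rw [hh (k + 1) (by omega), ih fun j hj => hh j (by omega)]

/-- With at least two blocks, no block is the whole set, so the value of `h` at `n` plays no role.
This makes the recursion well founded. -/
theorem numForests_congr_of_two_le {h h' : ℕ → Cardinal.{u}} {m : ℕ} (hm : 2 ≤ m) {n : ℕ}
    (hh : ∀ k, k < n → h k = h' k) : numForests h m n = numForests h' m n := by
  obtain ⟨m, rfl⟩ := Nat.exists_eq_add_of_le' hm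
  cases n with
  | zero => rfl
  | succ n =>
    rw [numForests, numForests]
    refine Finset.sum_congr rfl fun k hk => ?_
    rcases (Nat.lt_succ_iff.1 (Finset.mem_range.1 hk)).eq_or_lt with rfl | hk
    · rw [Nat.sub_self, numForests, numForests, mul_zero, mul_zero]
    · rw [hh (k + 1) (by omega), numForests_congr (m + 1) fun j hj => hh j (by omega)]

theorem mk_good_eq_sum (a : Label) (S : Finset ℕ) (h : ℕ → Cardinal.{u})
    (hh : ∀ U ⊆ S, U.Nonempty → U.card < S.card →
      Cardinal.mk {T : OpTree ι // IsChild a T U} = h U.card) :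
    Cardinal.mk {T : OpTree ι // Good (some a) T S} =
      ∑ m ∈ Finset.Icc 2 S.card, Cardinal.mk (ι a m) * numForests h m S.card := by
  rw [mk_good]
  refine Finset.sum_congr rfl fun m hm => ?_
  -- Counting forests asks for the number of children on every nonempty subset, including `S`
  -- itself. The true value is inserted there and then discarded, since `m ≥ 2`.
  rw [mk_isForest a m S (update h S.card (Cardinal.mk {T : OpTree ι // IsChild a T S}))]
  · rw [numForests_congr_of_two_le (Finset.mem_Icc.1 hm).1]
    intro k hk
    rw [update_of_ne hk.ne]
  · intro U hU hne
    rcases (Finset.card_le_card hU).eq_or_lt with hc | hc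
    · rw [hc, update_self, Finset.eq_of_subset_of_card_le hU hc.ge]
    · rw [update_of_ne hc.ne, hh U hU hne hc]

/-- The numbers of trees with few leaves. -/
noncomputable def numTrees (x y : ℕ → Cardinal.{u}) : ℕ → Cardinal.{u}
  | 1 => 1
  | 2 => x 2
  | 3 => x 3 + 3 * x 2 * y 2
  | 4 => x 4 + 6 * x 3 * y 2 + 3 * x 2 * y 2 ^ 2 + 4 * x 2 * y 3 + 12 * x 2 ^ 2 * y 2
  | 5 => x 5 + 10 * x 4 * y 2 + 5 * x 2 * y 4 + 15 * x 3 * y 2 ^ 2 + 30 * x 2 ^ 2 * y 3 +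
      50 * x 2 * x 3 * y 2 + 10 * x 2 * y 2 * y 3 + 90 * x 2 ^ 2 * y 2 ^ 2 +
      15 * x 2 ^ 3 * y 2 + 10 * x 3 * y 3
  | _ => 0

/-- The roles of `x` and `y` are exchanged inside `numForests` because subtrees carry the other root
label; the value `1` of `numTrees` at `1` accounts for bare leaves. -/
theorem sum_mul_numForests (x y : ℕ → Cardinal.{u}) {n : ℕ} (h2 : 2 ≤ n) (h5 : n ≤ 5) :
    ∑ m ∈ Finset.Icc 2 n, x m * numForests (numTrees y x) m n = numTrees x y n := by
  have h3 : Finset.Icc 2 3 = {2, 3} := rfl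
  have h4 : Finset.Icc 2 4 = {2, 3, 4} := rfl
  have h5' : Finset.Icc 2 5 = {2, 3, 4, 5} := rfl
  interval_cases n
  all_goals
    simp [h3, h4, h5', numForests, numTrees, Finset.sum_range_succ, Nat.choose]
    try ring

theorem mk_good_eq_numTrees (a : Label) (S : Finset ℕ) (h2 : 2 ≤ S.card) (h5 : S.card ≤ 5) :
    Cardinal.mk {T : OpTree ι // Good (some a) T S} =
      numTrees (fun m => Cardinal.mk (ι a m)) (fun m => Cardinal.mk (ι a.other m)) S.card := by
  induction hn : S.card using Nat.strong_induction_on generalizing a S with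
  | _ n ih =>
    subst hn
    rw [mk_good_eq_sum a S (numTrees (fun m => Cardinal.mk (ι a.other m))
      (fun m => Cardinal.mk (ι a m))), sum_mul_numForests _ _ h2 h5]
    intro U hU hne hc
    rcases Nat.lt_or_ge U.card 2 with hU2 | hU2
    · have : U.card = 1 := by
        have := hne.card_pos
        omega
      rw [mk_isChild_of_card_eq_one a this, this, numTrees]
    · rw [mk_isChild_of_two_le_card a hU2, ih _ hc a.other U hU2 (by omega) rfl]
      have : a.other.other = a := by cases a <;> rfl
      rw [this]

end OpTree

end SymmOperad

/-! ### The free product of two operads. -/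

namespace SymmOperad

open OpTree

variable {K : Type u} [Field K]

/-- The pair of the factors of a free product. -/
def factors (O₁ O₂ : SymmOperad K) : Label → SymmOperad K
  | .bullet => O₁
  | .circ => O₂

/-- The morphisms from the factors to a free product. -/
def factorHom {O₁ O₂ O : SymmOperad K} (π₁ : Hom O₁ O) (π₂ : Hom O₂ O) :
    ∀ a, Hom (factors O₁ O₂ a) O
  | .bullet => π₁
  | .circ => π₂

theorem IsFreeProduct.generates {O₁ O₂ O : SymmOperad K} {π₁ : Hom O₁ O} {π₂ : Hom O₂ O}
    (hO : IsFreeProduct π₁ π₂) : Generates (factorHom π₁ π₂) :=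
  fun Q hmap hone hcomp hπ =>
    hO.mem_of_closed Q hmap hone hcomp (hπ .bullet) (hπ .circ)

theorem rank_part_eq_numTrees {P : Label → SymmOperad K} {B : Bases P} {O : SymmOperad K}
    {π : ∀ a, Hom (P a) O} {A : Alg O (OpTree B.ι →₀ K)} (hgen : Generates π)
    (hA : ∀ a m (μ : (P a).obj m), A.act ((π a).app m μ) = (treeAlg B a).act μ) (a : Label)
    {n : ℕ} (h2 : 2 ≤ n) (h5 : n ≤ 5) :
    Module.rank K (part π a n) = numTrees (fun m => Module.rank K ((P a).obj m))
      (fun m => Module.rank K ((P a.other).obj m)) n := by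
  rw [rank_part hgen hA, mk_good_eq_numTrees a _ (by simpa using h2) (by simpa using h5),
    Finset.card_range]
  simp only [(B.basis _ _).mk_eq_rank'']

end SymmOperad

theorem mainTheorem2 {K : Type u} [Field K] (O₁ O₂ O : SymmOperad K)
    (h₁ : Module.rank K (O₁.obj 1) = 1) (h₂ : Module.rank K (O₂.obj 1) = 1)
    (π₁ : SymmOperad.Hom O₁ O) (π₂ : SymmOperad.Hom O₂ O)
    (hO : SymmOperad.IsFreeProduct π₁ π₂)
    (x y dBullet dCirc : ℕ → Cardinal.{u})
    (hx : ∀ m, x m = Module.rank K (O₁.obj m))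
    (hy : ∀ m, y m = Module.rank K (O₂.obj m))
    (hdBullet : ∀ n, dBullet n = Module.rank K (SymmOperad.bulletPart π₁ π₂ n))
    (hdCirc : ∀ n, dCirc n = Module.rank K (SymmOperad.circPart π₁ π₂ n)) :
    (∀ n, 2 ≤ n → IsCompl (SymmOperad.bulletPart π₁ π₂ n) (SymmOperad.circPart π₁ π₂ n)) ∧
    dBullet 3 = x 3 + 3 * x 2 * y 2 ∧
    dBullet 4 = x 4 + 6 * x 3 * y 2 + 3 * x 2 * y 2 ^ 2 + 4 * x 2 * y 3 + 12 * x 2 ^ 2 * y 2 ∧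
    dBullet 5 = x 5 + 10 * x 4 * y 2 + 5 * x 2 * y 4 + 15 * x 3 * y 2 ^ 2 + 30 * x 2 ^ 2 * y 3 +
      50 * x 2 * x 3 * y 2 + 10 * x 2 * y 2 * y 3 + 90 * x 2 ^ 2 * y 2 ^ 2 +
      15 * x 2 ^ 3 * y 2 + 10 * x 3 * y 3 ∧
    dCirc 3 = y 3 + 3 * y 2 * x 2 ∧
    dCirc 4 = y 4 + 6 * y 3 * x 2 + 3 * y 2 * x 2 ^ 2 + 4 * y 2 * x 3 + 12 * y 2 ^ 2 * x 2 ∧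
    dCirc 5 = y 5 + 10 * y 4 * x 2 + 5 * y 2 * x 4 + 15 * y 3 * x 2 ^ 2 + 30 * y 2 ^ 2 * x 3 +
      50 * y 2 * y 3 * x 2 + 10 * y 2 * x 2 * x 3 + 90 * y 2 ^ 2 * x 2 ^ 2 +
      15 * y 2 ^ 3 * x 2 + 10 * y 3 * x 3 := by
  obtain ⟨B⟩ := SymmOperad.exists_bases (SymmOperad.factors O₁ O₂) (by
    rintro (_ | _)
    · exact h₁
    · exact h₂)
  -- The two structures on the span of trees come from different identifications with free algebras;
  -- no compatibility between them is required.
  obtain ⟨A, hA₁, hA₂⟩ := hO.exists_alg (SymmOperad.treeAlg B .bullet) (SymmOperad.treeAlg B .circ)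
  have hA : ∀ a m (μ : (SymmOperad.factors O₁ O₂ a).obj m),
      A.act ((SymmOperad.factorHom π₁ π₂ a).app m μ) = (SymmOperad.treeAlg B a).act μ := by
    rintro (_ | _)
    · exact hA₁
    · exact hA₂
  have hgen := hO.generates
  obtain rfl : x = fun m => Module.rank K (O₁.obj m) := funext hx
  obtain rfl : y = fun m => Module.rank K (O₂.obj m) := funext hy
  have hb : ∀ n, 2 ≤ n → n ≤ 5 → dBullet n = SymmOperad.OpTree.numTrees
      (fun m => Module.rank K (O₁.obj m)) (fun m => Module.rank K (O₂.obj m)) n := fun n h2 h5 =>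
    (hdBullet n).trans (SymmOperad.rank_part_eq_numTrees hgen hA .bullet h2 h5)
  have hc : ∀ n, 2 ≤ n → n ≤ 5 → dCirc n = SymmOperad.OpTree.numTrees
      (fun m => Module.rank K (O₂.obj m)) (fun m => Module.rank K (O₁.obj m)) n := fun n h2 h5 =>
    (hdCirc n).trans (SymmOperad.rank_part_eq_numTrees hgen hA .circ h2 h5)
  exact ⟨fun n hn => SymmOperad.isCompl_part hgen hA hn,
    hb 3 (by norm_num) (by norm_num), hb 4 (by norm_num) (by norm_num),
    hb 5 (by norm_num) (by norm_num), hc 3 (by norm_num) (by norm_num),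
    hc 4 (by norm_num) (by norm_num), hc 5 (by norm_num) (by norm_num)⟩
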